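/- Let $\mathbb K$ be a field, $V$ a $\mathbb K$-vector space of finite dimension $\ell$, and $S=\mathrm{Sym}(V^*)$ its coordinate ring. For an arrangement $\mathcal A$ (a finite set of linear hyperplanes of $V$) let $$D(\mathcal A)=\{\theta\in\mathrm{Der}_{\mathbb K}(S) : \theta(\alpha)\in S\alpha \text{ for every linear form } \alpha\neq 0 \text{ with } \ker\alpha\in\mathcal A\},$$ graded so that $\theta$ has degree $m$ if $\theta(V^*)\subset S_m$. $\mathcal A$ is *free* with exponents the multiset $\exp(\mathcal A)=(e_1,\dots,e_\ell)$ if $D(\mathcal A)\cong\bigoplus_{k=1}^{\ell} S[-e_k]$ as graded $S$-modules. $\mathcal A$ is *SPOG* with $\mathrm{POexp}(\mathcal A)=(e_1,\dots,e_\ell)$ (a multiset containing $1$) and *level* $d$ if there is a minimal graded free resolution $$0\to S[-d-1]\to \bigoplus_{k=1}^{\ell} S[-e_k]\oplus S[-d]\to D(\mathcal A)\to 0 .$$ Let $H\in\mathcal A$, let $\mathcal A'=\mathcal A\setminus\{H\}$, and let $\mathcal A^H=\{H\cap L : L\in\mathcal A'\}$, an arrangement in the vector space $H$. Assume that $\mathcal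 A'$ is free with exponents $(1,d_2,\dots,d_\ell)$, where $d_2\le\dots\le d_\ell$, and that for some index $i$ with $2\le i\le \ell-1$ $$d:=d_i+d_\ell+|\mathcal A^H|-|\mathcal A'|>d_\ell .$$ Then the following two conditions are equivalent: 1. $\mathcal A^H$ is free with exponents $(1,d_2,\dots,d_{i-1},d_{i+1},\dots,d_{\ell-1},d)$, that is, $\exp(\mathcal A')$ with $d_i$ and $d_\ell$ removed and $d$ added; 2. $\mathcal A$ is SPOG with $\mathrm{POexp}(\mathcal A)=(1,d_2,\dots,d_{i-1},d_i+1,d_{i+1},\dots,d_{\ell-1},d_\ell+1)$ and level $d$. -/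

import Mathlib

/-- A central hyperplane arrangement in the vector space `V`: a finite set of linear
hyperplanes, that is, of maximal proper subspaces of `V`. -/
structure HypArrangement (K V : Type*) [Field K] [AddCommGroup V] [Module K V] where
  hyperplanes : Set (Submodule K V)
  finite : hyperplanes.Finite
  isCoatom : ∀ H ∈ hyperplanes, IsCoatom H

namespace HypArrangement

variable {K V : Type*} [Field K] [AddCommGroup V] [Module K V]

/-- The number of hyperplanes of an arrangement. -/
noncomputable def card (A : HypArrangement K V) : ℕ := A.hyperplanes.ncard

/-- The deletion: `A` without the hyperplane `H`. -/
def deletion (A : HypArrangement K V) (H : Submodule K V) : HypArrangement K V where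
  hyperplanes := A.hyperplanes \ {H}
  finite := A.finite.subset Set.sdiff_subset
  isCoatom := fun L hL => A.isCoatom L hL.1

/-- Two distinct hyperplanes meet in a hyperplane of either of them. -/
theorem isCoatom_comap_subtype {H L : Submodule K V} (hH : IsCoatom H) (hL : IsCoatom L)
    (hne : L ≠ H) : IsCoatom (L.comap H.subtype) := by
  constructor
  · intro h
    have hle : H ≤ L := by
      intro x hx
      have hmem : (⟨x, hx⟩ : H) ∈ L.comap H.subtype := by rw [h]; trivial
      exact hmem
    rcases hH.le_iff.1 hle with h1 | h1
    · exact hL.1 h1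
    · exact hne h1
  · intro P hP
    rw [eq_top_iff]
    rintro x -
    obtain ⟨p, hpP, hpL⟩ := SetLike.exists_of_lt hP
    have hpL' : (p : V) ∉ L := hpL
    have hsup : L ⊔ Submodule.span K {(p : V)} = ⊤ := by
      apply hL.2
      refine lt_of_le_of_ne le_sup_left ?_
      intro h
      apply hpL'
      rw [h]
      exact Submodule.mem_sup_right (Submodule.mem_span_singleton_self _)
    have hx : (x : V) ∈ L ⊔ Submodule.span K {(p : V)} := by rw [hsup]; trivial
    obtain ⟨y, hy, z, hz, hyz⟩ := Submodule.mem_sup.1 hx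
    obtain ⟨c, rfl⟩ := Submodule.mem_span_singleton.1 hz
    have hxy : x - c • p ∈ L.comap H.subtype := by
      have : ((x - c • p : H) : V) = y := by
        simp [← hyz]
      change ((x - c • p : H) : V) ∈ L
      rw [this]; exact hy
    have := P.add_mem (hP.le hxy) (P.smul_mem c hpP)
    simpa using this

/-- The restriction of `A` to `H ∈ A`: the arrangement in the vector space `H` consisting of
the intersections `H ∩ L`, where `L` runs over the other hyperplanes of `A`. -/
def restriction (A : HypArrangement K V) (H : Submodule K V) (hH : H ∈ A.hyperplanes) :
    HypArrangement K H where
  hyperplanes := (fun L : Submodule K V => L.comap H.subtype) '' (A.hyperplanes \ {H})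
  finite := (A.finite.subset Set.sdiff_subset).image _
  isCoatom := by
    rintro _ ⟨L, ⟨hL, hne⟩, rfl⟩
    exact isCoatom_comap_subtype (A.isCoatom H hH) (A.isCoatom L hL) hne

/-- The coordinate ring `S = Sym(V*)` of `V`. -/
abbrev CoordRing (K V : Type*) [Field K] [AddCommGroup V] [Module K V] : Type _ :=
  SymmetricAlgebra K (Module.Dual K V)

/-- A linear form on `V`, as an element of `S`. -/
noncomputable abbrev form (α : Module.Dual K V) : CoordRing K V :=
  SymmetricAlgebra.ι K (Module.Dual K V) α

/-- The homogeneous part of degree `m` of `S`: the span of the products of `m` linear forms. -/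
noncomputable def homogeneousPart (K V : Type*) [Field K] [AddCommGroup V] [Module K V]
    (m : ℕ) : Submodule K (CoordRing K V) :=
  LinearMap.range (SymmetricAlgebra.ι K (Module.Dual K V)) ^ m

/-- A derivation of `S` is homogeneous of (polynomial) degree `m` if it maps linear forms to
forms of degree `m`. -/
def IsHomogeneousOfDegree (θ : Derivation K (CoordRing K V) (CoordRing K V)) (m : ℕ) : Prop :=
  ∀ α : Module.Dual K V, θ (form α) ∈ homogeneousPart K V m

/-- The logarithmic derivation module `D(A)`: all derivations `θ` of `S` such that `α` divides
`θ(α)` for every linear form `α` whose kernel is a hyperplane of `A`. -/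
noncomputable def logDer (A : HypArrangement K V) :
    Submodule (CoordRing K V) (Derivation K (CoordRing K V) (CoordRing K V)) where
  carrier := {θ | ∀ α : Module.Dual K V, LinearMap.ker α ∈ A.hyperplanes →
    form α ∣ θ (form α)}
  zero_mem' := by
    intro α _
    simp
  add_mem' := by
    intro θ η hθ hη α hα
    simpa using dvd_add (hθ α hα) (hη α hα)
  smul_mem' := by
    intro s θ hθ α hα
    simpa using (hθ α hα).mul_left s

/-- `A` is free with the multiset `E` of exponents: `D(A)` is isomorphic, as a graded
`S`-module, to the direct sum of the modules `S[-e]` for `e ∈ E`; in other words, it has an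
`S`-basis of homogeneous derivations whose degrees form the multiset `E`. -/
def IsFreeWith (A : HypArrangement K V) (E : Multiset ℕ) : Prop :=
  ∃ (r : ℕ) (e : Fin r → ℕ) (b : Module.Basis (Fin r) (CoordRing K V) A.logDer),
    Finset.univ.val.map e = E ∧
    ∀ k, IsHomogeneousOfDegree (b k : Derivation K (CoordRing K V) (CoordRing K V)) (e k)

/-- `A` is SPOG with the multiset `E` of exponents (which has to contain `1`) and with level
`d`: there is a minimal graded free resolution
`0 ⟶ S[-d-1] ⟶ (⨁ₖ S[-eₖ]) ⊕ S[-d] ⟶ D(A) ⟶ 0`, where `E = {e₁, …, eᵣ}`.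
The maps `ψ`, `π` are homogeneous of degree zero: `π` maps the basis vector of degree `eₖ`
(respectively `d`) to a derivation of that degree, and the component of `ψ(1)` at the basis
vector of degree `eₖ` (respectively `d`) is zero or a form of degree `d + 1 - eₖ`
(respectively `1`). Minimality says that the components of `ψ(1)` lie in the ideal
generated by the linear forms. -/
def IsSPOGWith (A : HypArrangement K V) (E : Multiset ℕ) (d : ℕ) : Prop :=
  1 ∈ E ∧
  ∃ (r : ℕ) (e : Fin r → ℕ)
    (ψ : CoordRing K V →ₗ[CoordRing K V] (Fin r → CoordRing K V) × CoordRing K V)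
    (π : (Fin r → CoordRing K V) × CoordRing K V →ₗ[CoordRing K V] A.logDer),
    Finset.univ.val.map e = E ∧
    Function.Injective ψ ∧ Function.Exact ψ π ∧ Function.Surjective π ∧
    (∀ k, IsHomogeneousOfDegree
      (π (Pi.single k 1, 0) : Derivation K (CoordRing K V) (CoordRing K V)) (e k)) ∧
    IsHomogeneousOfDegree
      (π (0, 1) : Derivation K (CoordRing K V) (CoordRing K V)) d ∧
    (∀ k, (ψ 1).1 k = 0 ∨ ∃ m : ℕ, e k + m = d + 1 ∧ (ψ 1).1 k ∈ homogeneousPart K V m) ∧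
    (ψ 1).2 ∈ homogeneousPart K V 1 ∧
    (∀ k, (ψ 1).1 k ∈ Ideal.span (Set.range (form (K := K) (V := V)))) ∧
    (ψ 1).2 ∈ Ideal.span (Set.range (form (K := K) (V := V)))

end HypArrangement

/-! Write `A'` for the deletion, let `α` be a linear form with kernel `H`, and let `S_H = S/(α)` be
the coordinate ring of `H`. Evaluating at `α` and restricting to `H` gives a map `D(A') → S_H` with
kernel `D(A)`. Its image `I` is a graded ideal, generated by the values `F k` of a homogeneous basis
`θ k` of `D(A')`. Every value is divisible by one form `B` of degree `b = |A'| - |A^H|`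
(`exists_common_divisor`), so `F k = B * f k`, and the level is `δ = d_i + d_ℓ - b`.

Both conditions are shown to be equivalent to a third one: `I` has the Hilbert function of
`S_H[-d_i] ⊕ S_H[-d_ℓ]` minus that of `S_H[-δ]`, as if it were `B` times a complete intersection.

Each condition implies the third by counting dimensions in `0 → D(A) → D(A') → I → 0`. Under SPOG
the dimensions of `D(A)` come from the resolution. If `A^H` is free they come from `0 → D(A')[-1] →
D(A) → D(A^H) → 0`, where the first map is multiplication by `α`. The last map is onto because
`D(A')` is free (`restrictDer_surjective`).

Conversely, the Hilbert function determines the structure. By `exists_two_generators`, two values `F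
a`, `F c` of degrees `d_i`, `d_ℓ` generate `I`, and their only syzygies are the multiples of `(f c,
-f a)`. Hence (`exists_generators`) `D(A)` is generated by `α θ_a`, `α θ_c`, corrections of the
other `θ k` by multiples of `θ_a` and `θ_c`, and one derivation `φ` of degree `δ` that lifts the
trivial syzygy. The only relation expresses `α φ` through `α θ_a` and `α θ_c`. This is the SPOG
resolution; restricting to `H` kills `α θ_a` and `α θ_c` and leaves a basis of `D(A^H)`. -/

namespace HypArrangement

variable {K V W : Type*} [Field K] [AddCommGroup V] [Module K V] [AddCommGroup W] [Module K W]

/-! ### The coordinate ring -/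

theorem homogeneousPart_zero : homogeneousPart K V 0 = 1 := pow_zero _

theorem form_mem (γ : Module.Dual K V) : form γ ∈ homogeneousPart K V 1 := by
  rw [homogeneousPart, pow_one]
  exact ⟨γ, rfl⟩

instance : SetLike.GradedMonoid (homogeneousPart K V) where
  one_mem := Submodule.one_le.1 (by rw [homogeneousPart_zero])
  mul_mem i j a b ha hb := by
    rw [homogeneousPart, pow_add]
    exact Submodule.mul_mem_mul ha hb

/-- Linear forms as elements of degree one of the direct sum of the homogeneous parts. -/
noncomputable def gradedForm :
    Module.Dual K V →ₗ[K] DirectSum ℕ fun i => homogeneousPart K V i :=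
  DirectSum.lof K ℕ (fun i => homogeneousPart K V i) 1 ∘ₗ
    (SymmetricAlgebra.ι K (Module.Dual K V)).codRestrict (homogeneousPart K V 1) form_mem

/-- The decomposition is the algebra homomorphism that puts every linear form in degree one. It is
inverse to the summation map: one composite is checked on linear forms, the other by induction on
products of them. -/
noncomputable instance : GradedAlgebra (homogeneousPart K V) :=
  GradedAlgebra.ofAlgHom _ (SymmetricAlgebra.lift (gradedForm (K := K) (V := V)))
    (by
      apply SymmetricAlgebra.algHom_ext
      apply LinearMap.ext
      intro γ
      change DirectSum.coeAlgHom (homogeneousPart K V) (SymmetricAlgebra.lift gradedForm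
        (SymmetricAlgebra.ι K _ γ)) = SymmetricAlgebra.ι K _ γ
      rw [SymmetricAlgebra.lift_ι_apply]
      exact DirectSum.coeAlgHom_of (homogeneousPart K V) 1 ⟨form γ, form_mem γ⟩)
    fun i x => by
    obtain ⟨x, hx⟩ := x
    simp only
    induction hx using Submodule.pow_induction_on_left' with
    | algebraMap r =>
      rw [AlgHom.commutes, DirectSum.algebraMap_apply]; rfl
    | add x y i hx hy ihx ihy =>
      rw [map_add, ihx, ihy, ← map_add]
      rfl
    | mem_mul m hm i x hx ih =>
      obtain ⟨γ, rfl⟩ := hm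
      rw [map_mul, ih, SymmetricAlgebra.lift_ι_apply]
      change DirectSum.of (fun i => homogeneousPart K V i) 1 ⟨form γ, form_mem γ⟩ *
        DirectSum.of (fun i => homogeneousPart K V i) i ⟨x, hx⟩ = _
      rw [DirectSum.of_mul_of]
      exact DirectSum.of_eq_of_gradedMonoid_eq (Sigma.subtype_ext (add_comm _ _) rfl)

instance [FiniteDimensional K V] (m : ℕ) : FiniteDimensional K (homogeneousPart K V m) := by
  rw [FiniteDimensional, Module.Finite.iff_fg]
  exact (Module.Finite.iff_fg.1 inferInstance :
    (LinearMap.range (SymmetricAlgebra.ι K (Module.Dual K V))).FG).pow m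

theorem finrank_homogeneousPart_zero : Module.finrank K (homogeneousPart K V 0) = 1 := by
  rw [homogeneousPart_zero, Submodule.one_eq_span]
  exact finrank_span_singleton one_ne_zero

/-- Transported from a polynomial ring. Factoriality is what allows derivations of `H` to be lifted
prime by prime in `restrictDer_surjective`. -/
instance [FiniteDimensional K V] : UniqueFactorizationMonoid (CoordRing K V) :=
  (SymmetricAlgebra.equivMvPolynomial
    (Module.finBasis K (Module.Dual K V))).symm.toMulEquiv.uniqueFactorizationMonoid inferInstance

theorem homogeneousPart_le_span {m : ℕ} (hm : 0 < m) {x : CoordRing K V}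
    (hx : x ∈ homogeneousPart K V m) :
    x ∈ Ideal.span (Set.range (form (K := K) (V := V))) := by
  obtain ⟨m, rfl⟩ := Nat.exists_eq_succ_of_ne_zero hm.ne'
  rw [homogeneousPart, Nat.succ_eq_add_one, pow_succ] at hx
  induction hx using Submodule.mul_induction_on' with
  | mem_mul_mem a ha b hb =>
    obtain ⟨γ, rfl⟩ := hb
    exact Ideal.mul_mem_left _ _ (Ideal.subset_span ⟨γ, rfl⟩)
  | add a ha b hb iha ihb => exact Ideal.add_mem _ iha ihb

/-! ### Derivations of the coordinate ring -/

theorem derivation_ext {θ η : Derivation K (CoordRing K V) (CoordRing K V)}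
    (h : ∀ γ, θ (form γ) = η (form γ)) : θ = η := by
  apply Derivation.ext
  intro x
  induction x using SymmetricAlgebra.induction with
  | algebraMap r => rw [Derivation.map_algebraMap, Derivation.map_algebraMap]
  | ι γ => exact h γ
  | mul a b ha hb => rw [Derivation.leibniz, Derivation.leibniz, ha, hb]
  | add a b ha hb => rw [map_add, map_add, ha, hb]

/-- The algebra homomorphism to the dual numbers that encodes the derivation with given values on
the linear forms. -/
noncomputable def toDualNumbers (g : Module.Dual K V →ₗ[K] CoordRing K V) :
    CoordRing K V →ₐ[K] TrivSqZeroExt (CoordRing K V) (CoordRing K V) :=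
  SymmetricAlgebra.lift
    ((TrivSqZeroExt.inlAlgHom K (CoordRing K V) (CoordRing K V)).toLinearMap ∘ₗ
      SymmetricAlgebra.ι K (Module.Dual K V) +
      (TrivSqZeroExt.inrHom (CoordRing K V) (CoordRing K V)).restrictScalars K ∘ₗ g)

theorem toDualNumbers_form (g : Module.Dual K V →ₗ[K] CoordRing K V) (γ : Module.Dual K V) :
    toDualNumbers g (form γ) = TrivSqZeroExt.inl (form γ) + TrivSqZeroExt.inr (g γ) :=
  SymmetricAlgebra.lift_ι_apply _ _

theorem fst_toDualNumbers (g : Module.Dual K V →ₗ[K] CoordRing K V) (x : CoordRing K V) :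
    (toDualNumbers g x).fst = x := by
  have : (TrivSqZeroExt.fstHom K (CoordRing K V) (CoordRing K V)).comp (toDualNumbers g) =
      AlgHom.id K _ := by
    apply SymmetricAlgebra.algHom_ext
    apply LinearMap.ext
    intro γ
    change (toDualNumbers g (form γ)).fst = form γ
    rw [toDualNumbers_form]
    simp
  exact DFunLike.congr_fun this x

/-- The derivation with given values on the linear forms. -/
noncomputable def derivationOf (g : Module.Dual K V →ₗ[K] CoordRing K V) :
    Derivation K (CoordRing K V) (CoordRing K V) :=
  Derivation.mk' ((TrivSqZeroExt.sndHom (CoordRing K V) (CoordRing K V)).restrictScalars K ∘ₗ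
    (toDualNumbers g).toLinearMap) (by
      intro a b
      change (toDualNumbers g (a * b)).snd = a • (toDualNumbers g b).snd +
        b • (toDualNumbers g a).snd
      rw [map_mul, TrivSqZeroExt.snd_mul, fst_toDualNumbers, fst_toDualNumbers]
      simp [mul_comm])

@[simp]
theorem derivationOf_form (g : Module.Dual K V →ₗ[K] CoordRing K V) (γ : Module.Dual K V) :
    derivationOf g (form γ) = g γ := by
  change (toDualNumbers g (form γ)).snd = _
  rw [toDualNumbers_form]
  simp

/-! ### Functoriality of the coordinate ring -/

/-- The pullback of polynomial functions along a linear map. -/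
noncomputable def pullback (f : V →ₗ[K] W) : CoordRing K W →ₐ[K] CoordRing K V :=
  SymmetricAlgebra.lift (SymmetricAlgebra.ι K (Module.Dual K V) ∘ₗ f.dualMap)

@[simp]
theorem pullback_form (f : V →ₗ[K] W) (γ : Module.Dual K W) :
    pullback f (form γ) = form (γ ∘ₗ f) :=
  SymmetricAlgebra.lift_ι_apply _ _

theorem pullback_mem (f : V →ₗ[K] W) {m : ℕ} {x : CoordRing K W}
    (hx : x ∈ homogeneousPart K W m) : pullback f x ∈ homogeneousPart K V m := by
  have h : (homogeneousPart K W m).map (pullback f).toLinearMap ≤ homogeneousPart K V m := by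
    rw [homogeneousPart, Submodule.map_pow]
    apply pow_le_pow_left'
    rintro _ ⟨_, ⟨γ, rfl⟩, rfl⟩
    exact ⟨γ ∘ₗ f, (pullback_form f γ).symm⟩
  exact h ⟨x, hx, rfl⟩

end HypArrangement

namespace HypArrangement

variable {K V : Type*} [Field K] [AddCommGroup V] [Module K V]

/-! ### Linear forms and hyperplanes -/

theorem form_injective : Function.Injective (form (K := K) (V := V)) := by
  rw [injective_iff_map_eq_zero (SymmetricAlgebra.ι K (Module.Dual K V))]
  intro γ hγ
  apply LinearMap.ext
  intro w
  -- The directional derivative along `w` takes the constant value `γ w` at `form γ`, so `form γ`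
  -- determines `γ`.
  have h := derivationOf_form
    ((Algebra.linearMap K (CoordRing K V)) ∘ₗ Module.Dual.eval K V w) γ
  rw [show form γ = 0 from hγ, map_zero] at h
  exact (map_eq_zero (algebraMap K (CoordRing K V))).1 h.symm

theorem form_eq_zero_iff {γ : Module.Dual K V} : form γ = 0 ↔ γ = 0 :=
  map_eq_zero_iff (SymmetricAlgebra.ι K (Module.Dual K V)) form_injective

theorem ne_zero_of_isCoatom_ker {γ : Module.Dual K V} (h : IsCoatom (LinearMap.ker γ)) :
    γ ≠ 0 := by
  rintro rfl
  exact h.1 LinearMap.ker_zero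

theorem exists_ker_eq {L : Submodule K V} (hL : IsCoatom L) :
    ∃ γ : Module.Dual K V, LinearMap.ker γ = L := by
  obtain ⟨γ, hγ, hle⟩ := Submodule.exists_le_ker_of_lt_top L hL.lt_top
  refine ⟨γ, (hL.le_iff.1 hle).resolve_left fun h => hγ (LinearMap.ker_eq_top.1 h)⟩

theorem exists_eq_smul_of_ker_le {γ γ' : Module.Dual K V}
    (h : LinearMap.ker γ ≤ LinearMap.ker γ') : ∃ c : K, γ' = c • γ := by
  have := mem_span_of_iInf_ker_le_ker (L := fun _ : Unit => γ) (K := γ') (by simpa using h)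
  simp only [Set.range_const] at this
  obtain ⟨c, rfl⟩ := Submodule.mem_span_singleton.1 this
  exact ⟨c, rfl⟩

theorem form_smul (c : K) (γ : Module.Dual K V) : form (c • γ) = c • form γ := map_smul _ c γ

theorem smul_dvd_smul_iff {c : K} (hc : c ≠ 0) {x y : CoordRing K V} :
    c • x ∣ c • y ↔ x ∣ y := by
  rw [Algebra.smul_def, Algebra.smul_def]
  exact mul_dvd_mul_iff_left ((map_ne_zero (algebraMap K (CoordRing K V))).2 hc)

theorem dvd_smul_iff {c : K} (hc : c ≠ 0) {x y : CoordRing K V} : x ∣ c • y ↔ x ∣ y := by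
  rw [Algebra.smul_def]
  exact (hc.isUnit.map (algebraMap K (CoordRing K V))).dvd_mul_left

/-- For a derivation, dividing its value at a linear form depends only on the kernel of the
form. -/
theorem form_dvd_of_ker_eq {γ γ' : Module.Dual K V} (h : LinearMap.ker γ = LinearMap.ker γ')
    (hγ' : γ' ≠ 0) {θ : Derivation K (CoordRing K V) (CoordRing K V)}
    (hθ : form γ ∣ θ (form γ)) : form γ' ∣ θ (form γ') := by
  obtain ⟨c, rfl⟩ := exists_eq_smul_of_ker_le h.le
  have hc : c ≠ 0 := by
    rintro rfl
    exact hγ' (zero_smul K γ)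
  rw [form_smul, Derivation.map_smul]
  exact (smul_dvd_smul_iff hc).2 hθ

section Hyperplane

variable {H : Submodule K V} {α : Module.Dual K V} {v : V}

/-- The projection to the kernel of `α` along a vector `v` with `α v = 1`. -/
def hyperProj (hα : LinearMap.ker α = H) (hv : α v = 1) : V →ₗ[K] H :=
  (LinearMap.id - (LinearMap.toSpanSingleton K V v) ∘ₗ α).codRestrict H (by
    intro x
    rw [← hα]
    simp [hv])

theorem hyperProj_apply (hα : LinearMap.ker α = H) (hv : α v = 1) (x : V) :
    (hyperProj hα hv x : V) = x - α x • v := rfl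

theorem hyperProj_comp_subtype (hα : LinearMap.ker α = H) (hv : α v = 1) :
    hyperProj hα hv ∘ₗ H.subtype = LinearMap.id := by
  apply LinearMap.ext
  rintro ⟨x, hx⟩
  apply Subtype.ext
  have : α x = 0 := by rwa [← hα] at hx
  change (hyperProj hα hv x : V) = x
  rw [hyperProj_apply, this, zero_smul, sub_zero]

theorem eq_comp_add (hα : LinearMap.ker α = H) (hv : α v = 1) (γ : Module.Dual K V) :
    γ = (γ ∘ₗ H.subtype) ∘ₗ hyperProj hα hv + γ v • α := by
  apply LinearMap.ext
  intro x
  change γ x = γ (hyperProj hα hv x : V) + γ v * α x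
  rw [hyperProj_apply, map_sub, map_smul, smul_eq_mul]
  ring

theorem form_eq_add (hα : LinearMap.ker α = H) (hv : α v = 1) (γ : Module.Dual K V) :
    form γ = form ((γ ∘ₗ H.subtype) ∘ₗ hyperProj hα hv) + γ v • form α := by
  conv_lhs => rw [eq_comp_add hα hv γ]
  rw [← form_smul]
  exact map_add _ _ _

theorem pullback_pullback (hα : LinearMap.ker α = H) (hv : α v = 1) (x : CoordRing K H) :
    pullback H.subtype (pullback (hyperProj hα hv) x) = x := by
  have : (pullback H.subtype).comp (pullback (hyperProj hα hv)) = AlgHom.id K _ := by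
    apply SymmetricAlgebra.algHom_ext
    apply LinearMap.ext
    intro γ
    change pullback H.subtype (pullback (hyperProj hα hv) (form γ)) = form γ
    rw [pullback_form, pullback_form, LinearMap.comp_assoc, hyperProj_comp_subtype,
      LinearMap.comp_id]
  exact DFunLike.congr_fun this x

theorem pullback_subtype_form (hα : LinearMap.ker α = H) :
    pullback H.subtype (form α) = 0 := by
  rw [pullback_form, form_eq_zero_iff]
  apply LinearMap.ext
  rintro ⟨x, hx⟩
  rwa [← hα] at hx

/-- Restricting to `H` and extending back along `v` changes a linear form `γ` only by `γ v • α`, so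
two algebra homomorphisms to `S/(α)` agree on generators. -/
theorem form_dvd_sub (hα : LinearMap.ker α = H) (hv : α v = 1) (x : CoordRing K V) :
    form α ∣ x - pullback (hyperProj hα hv) (pullback H.subtype x) := by
  have : (Ideal.Quotient.mkₐ K (Ideal.span {form α})).comp
      ((pullback (hyperProj hα hv)).comp (pullback H.subtype)) =
      Ideal.Quotient.mkₐ K (Ideal.span {form α}) := by
    apply SymmetricAlgebra.algHom_ext
    apply LinearMap.ext
    intro γ
    change Ideal.Quotient.mk _ (pullback (hyperProj hα hv) (pullback H.subtype (form γ))) =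
      Ideal.Quotient.mk _ (form γ)
    rw [pullback_form, pullback_form, eq_comm, Ideal.Quotient.eq, Ideal.mem_span_singleton]
    refine ⟨algebraMap K _ (γ v), ?_⟩
    conv_lhs => rw [form_eq_add hα hv γ]
    rw [add_sub_cancel_left, Algebra.smul_def, mul_comm]
  have h := DFunLike.congr_fun this x
  exact Ideal.mem_span_singleton.1 (Ideal.Quotient.eq.1 h.symm)

theorem exists_apply_eq_one (hα : α ≠ 0) : ∃ v, α v = 1 := by
  obtain ⟨w, hw⟩ : ∃ w, α w ≠ 0 := by
    by_contra! h
    exact hα (LinearMap.ext h)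
  exact ⟨(α w)⁻¹ • w, by rw [map_smul, smul_eq_mul, inv_mul_cancel₀ hw]⟩

/-- This identifies `S/(α)` with the coordinate ring of `H`, and turns every divisibility by `α`
into an equation there. -/
theorem pullback_subtype_eq_zero_iff (hα : LinearMap.ker α = H) (h0 : α ≠ 0)
    {x : CoordRing K V} : pullback H.subtype x = 0 ↔ form α ∣ x := by
  obtain ⟨v, hv⟩ := exists_apply_eq_one h0
  constructor
  · intro h
    have := form_dvd_sub hα hv x
    rwa [h, map_zero, sub_zero] at this
  · rintro ⟨y, rfl⟩
    rw [map_mul, pullback_subtype_form hα, zero_mul]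

end Hyperplane

/-- `α` generates the kernel of a homomorphism to a domain, the coordinate ring of its hyperplane.
-/
theorem prime_form {α : Module.Dual K V} (h0 : α ≠ 0) : Prime (form α) := by
  refine ⟨fun h => h0 (form_eq_zero_iff.1 h), fun h => ?_, fun a b hab => ?_⟩
  · have := (pullback_subtype_eq_zero_iff rfl h0).2 (h.dvd : form α ∣ 1)
    rw [map_one] at this
    exact one_ne_zero this
  · rw [← pullback_subtype_eq_zero_iff rfl h0] at hab ⊢
    rw [← pullback_subtype_eq_zero_iff rfl h0]
    rwa [map_mul, mul_eq_zero] at hab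

theorem ker_le_of_form_dvd {γ γ' : Module.Dual K V} (h : form γ ∣ form γ') :
    LinearMap.ker γ ≤ LinearMap.ker γ' := by
  by_cases h0 : γ = 0
  · rw [form_eq_zero_iff.2 h0, zero_dvd_iff, form_eq_zero_iff] at h
    rw [h, LinearMap.ker_zero]
    exact le_top
  · rw [← pullback_subtype_eq_zero_iff rfl h0, pullback_form, form_eq_zero_iff] at h
    intro x hx
    exact LinearMap.congr_fun h ⟨x, hx⟩

theorem ker_eq_of_form_dvd {γ γ' : Module.Dual K V} (h0 : γ' ≠ 0) (h : form γ ∣ form γ') :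
    LinearMap.ker γ = LinearMap.ker γ' := by
  obtain ⟨c, rfl⟩ := exists_eq_smul_of_ker_le (ker_le_of_form_dvd h)
  have hc : c ≠ 0 := by
    rintro rfl
    exact h0 (zero_smul K γ)
  exact (LinearMap.ker_smul γ c hc).symm

theorem isRelPrime_form {γ γ' : Module.Dual K V} (h : γ ≠ 0) (h' : γ' ≠ 0)
    (hne : LinearMap.ker γ ≠ LinearMap.ker γ') : IsRelPrime (form γ) (form γ') :=
  ((prime_form h).irreducible.isRelPrime_iff_not_dvd).2 fun hd => hne (ker_eq_of_form_dvd h' hd)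

end HypArrangement

namespace HypArrangement

/-- Exactness by dimension count: an injective image inside a kernel of no larger dimension fills
it. It serves to show that trivial syzygies are the only ones. -/
theorem exists_of_finrank_ker_le {K X Y Z : Type*} [Field K] [AddCommGroup X] [Module K X]
    [AddCommGroup Y] [Module K Y] [AddCommGroup Z] [Module K Z] [FiniteDimensional K Y]
    {g : X →ₗ[K] Y} {f : Y →ₗ[K] Z} (hg : Function.Injective g) (hfg : ∀ x, f (g x) = 0)
    (h : Module.finrank K (LinearMap.ker f) ≤ Module.finrank K X) {y : Y} (hy : f y = 0) :
    ∃ x, g x = y := by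
  have hle : LinearMap.range g ≤ LinearMap.ker f := by
    rintro _ ⟨x, rfl⟩
    exact hfg x
  have heq := Submodule.eq_of_le_of_finrank_le hle (by rwa [LinearMap.finrank_range_of_inj hg])
  exact LinearMap.mem_range.1 (heq ▸ hy : y ∈ LinearMap.range g)

/-! ### Shifted graded rings -/

section Graded

variable {K R : Type*} [Field K] [CommRing R] [Algebra K R] (𝒜 : ℕ → Submodule K R)

/-- The part of degree `m` of the graded module `R[-e]`. -/
def shiftedPart (e m : ℕ) : Submodule K R := if e ≤ m then 𝒜 (m - e) else ⊥

theorem shiftedPart_of_le {e m : ℕ} (h : e ≤ m) : shiftedPart 𝒜 e m = 𝒜 (m - e) := if_pos h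

theorem shiftedPart_of_lt {e m : ℕ} (h : m < e) : shiftedPart 𝒜 e m = ⊥ := if_neg h.not_ge

theorem shiftedPart_self (e : ℕ) : shiftedPart 𝒜 e e = 𝒜 0 := by
  rw [shiftedPart_of_le 𝒜 le_rfl, Nat.sub_self]

theorem shiftedPart_zero (m : ℕ) : shiftedPart 𝒜 0 m = 𝒜 m := shiftedPart_of_le 𝒜 (Nat.zero_le m)

theorem le_of_mem_shiftedPart {e m : ℕ} {x : R} (hx : x ∈ shiftedPart 𝒜 e m) (h0 : x ≠ 0) :
    e ≤ m := by
  by_contra h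
  rw [shiftedPart_of_lt 𝒜 (not_le.1 h)] at hx
  exact h0 hx

theorem mem_of_mem_shiftedPart {e m j : ℕ} {x : R} (hx : x ∈ shiftedPart 𝒜 e m)
    (h : e ≤ m → m = j + e) : x ∈ 𝒜 j := by
  by_cases hem : e ≤ m
  · rw [shiftedPart_of_le 𝒜 hem] at hx
    rwa [h hem, Nat.add_sub_cancel] at hx
  · rw [shiftedPart_of_lt 𝒜 (not_le.1 hem)] at hx
    rw [show x = 0 from hx]
    exact zero_mem _

theorem mem_shiftedPart {e m j : ℕ} {x : R} (hx : x ∈ 𝒜 j) (h : j + e = m) :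
    x ∈ shiftedPart 𝒜 e m := by
  subst h
  rwa [shiftedPart_of_le 𝒜 (Nat.le_add_left _ _), Nat.add_sub_cancel]

theorem mem_shiftedPart_cases {e m : ℕ} {x : R} (hx : x ∈ shiftedPart 𝒜 e m) :
    x = 0 ∨ ∃ j, j + e = m ∧ x ∈ 𝒜 j := by
  by_cases h : e ≤ m
  · exact Or.inr ⟨m - e, Nat.sub_add_cancel h, by rwa [shiftedPart_of_le 𝒜 h] at hx⟩
  · rw [shiftedPart_of_lt 𝒜 (not_le.1 h)] at hx
    exact Or.inl hx

instance [∀ m, FiniteDimensional K (𝒜 m)] (e m : ℕ) :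
    FiniteDimensional K (shiftedPart 𝒜 e m) := by
  by_cases h : e ≤ m
  · rw [shiftedPart_of_le 𝒜 h]; infer_instance
  · rw [shiftedPart_of_lt 𝒜 (not_le.1 h)]; infer_instance

variable [GradedAlgebra 𝒜]

theorem mul_mem_shiftedPart {a b c : ℕ} {x y : R} (hx : x ∈ shiftedPart 𝒜 b c)
    (hy : y ∈ shiftedPart 𝒜 a b) : x * y ∈ shiftedPart 𝒜 a c := by
  rcases mem_shiftedPart_cases 𝒜 hx with rfl | ⟨j, hj, hx⟩
  · simp
  rcases mem_shiftedPart_cases 𝒜 hy with rfl | ⟨k, hk, hy⟩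
  · simp
  exact mem_shiftedPart 𝒜 (SetLike.GradedMul.mul_mem hx hy) (by omega)

theorem mul_mem_of_mem_shiftedPart {e m : ℕ} {x y : R} (hx : x ∈ shiftedPart 𝒜 e m)
    (hy : y ∈ 𝒜 e) : x * y ∈ 𝒜 m := by
  rw [← shiftedPart_zero 𝒜] at hy ⊢
  exact mul_mem_shiftedPart 𝒜 hx hy

/-- The component of `x` in the part of degree `m` of `R[-e]`. -/
def shiftedComponent (e m : ℕ) (x : R) : R :=
  if e ≤ m then (DirectSum.decompose 𝒜 x (m - e) : R) else 0

theorem shiftedComponent_mem (e m : ℕ) (x : R) :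
    shiftedComponent 𝒜 e m x ∈ shiftedPart 𝒜 e m := by
  unfold shiftedComponent shiftedPart
  split_ifs
  · exact SetLike.coe_mem _
  · exact zero_mem _

theorem shiftedComponent_add (e j : ℕ) (x : R) :
    shiftedComponent 𝒜 e (j + e) x = DirectSum.decompose 𝒜 x j := by
  rw [shiftedComponent, if_pos (Nat.le_add_left _ _), Nat.add_sub_cancel]

theorem decompose_mul_of_mem {e : ℕ} (m : ℕ) (x : R) {y : R} (hy : y ∈ 𝒜 e) :
    (DirectSum.decompose 𝒜 (x * y) m : R) = shiftedComponent 𝒜 e m x * y := by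
  rw [DirectSum.coe_decompose_mul_of_right_mem 𝒜 m hy, shiftedComponent]
  split_ifs <;> simp

theorem dvd_of_forall_dvd_decompose {x y : R}
    (h : ∀ m, y ∣ (DirectSum.decompose 𝒜 x m : R)) : y ∣ x := by
  classical
  rw [← DirectSum.sum_support_decompose 𝒜 x]
  exact Finset.dvd_sum fun m _ => h m

/-- The product `x * y` is its own component of degree `m`, which is a homogeneous component of `x`
times `y`; cancel `y`. -/
theorem mem_shiftedPart_of_mul_mem [IsDomain R] {e m : ℕ} {x y : R} (hy : y ∈ 𝒜 e)
    (h0 : y ≠ 0) (h : x * y ∈ 𝒜 m) : x ∈ shiftedPart 𝒜 e m := by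
  have h1 : x * y = shiftedComponent 𝒜 e m x * y := by
    rw [← decompose_mul_of_mem 𝒜 m x hy, DirectSum.decompose_of_mem_same 𝒜 h]
  rw [mul_right_cancel₀ h0 h1]
  exact shiftedComponent_mem 𝒜 e m x

/-! ### Ideals with the Hilbert function of a complete intersection -/

variable [IsDomain R] [∀ m, FiniteDimensional K (𝒜 m)]

/-- If `I` is a graded ideal generated by homogeneous elements `F k = B * f k` of degrees at most
`q`, and up to the shift by `deg B` it has the Hilbert function of a complete intersection of
degrees `p` and `q`, then it is generated by two of the elements `F k`, and the syzygies of these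
two are the trivial ones. -/
theorem exists_two_generators {ι : Type*} [Fintype ι] (h1 : Module.finrank K (𝒜 0) = 1)
    {d : ι → ℕ} {F f : ι → R} (hF : ∀ k, F k ∈ 𝒜 (d k)) {B : R} (hB0 : B ≠ 0)
    (hf : ∀ k, F k = B * f k) {p q δ b : ℕ} (hfmem : ∀ k, f k ∈ shiftedPart 𝒜 b (d k))
    (hpq : p ≤ q) (hqδ : q < δ) (hδ : δ + b = p + q) (hd : ∀ k, d k ≤ q)
    {I : ℕ → Submodule K R}
    (hI : ∀ m x, x ∈ I m ↔ ∃ g : ι → R, (∀ k, g k ∈ shiftedPart 𝒜 (d k) m) ∧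
      x = ∑ k, g k * F k)
    (hdim : ∀ m, Module.finrank K (I m) + Module.finrank K (shiftedPart 𝒜 δ m) =
      Module.finrank K (shiftedPart 𝒜 p m) + Module.finrank K (shiftedPart 𝒜 q m)) :
    ∃ a c, a ≠ c ∧ d a = p ∧ d c = q ∧ F a ≠ 0 ∧ F c ≠ 0 ∧
      (∀ k, ∃ x ∈ shiftedPart 𝒜 p (d k), ∃ y ∈ shiftedPart 𝒜 q (d k),
        F k = x * F a + y * F c) ∧
      ∀ x y, x * F a + y * F c = 0 → ∃ t, x = t * f c ∧ y = -(t * f a) := by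
  classical
  have hone : (1 : R) ∈ 𝒜 0 := SetLike.GradedOne.one_mem
  have hmemI : ∀ {k m g}, g ∈ shiftedPart 𝒜 (d k) m → g * F k ∈ I m := by
    intro k m g hg
    refine (hI _ _).2 ⟨Pi.single k g, fun j => ?_, ?_⟩
    · by_cases hj : j = k
      · subst hj; simpa using hg
      · simp [hj]
    · rw [Finset.sum_eq_single k] <;> simp +contextual
  have hFI : ∀ k, F k ∈ I (d k) := fun k => by
    have := hmemI (k := k) (m := d k) (g := 1) (by rwa [shiftedPart_self])
    rwa [one_mul] at this
  have hIle : ∀ m, I m ≤ 𝒜 m := by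
    intro m x hx
    obtain ⟨g, hg, rfl⟩ := (hI _ _).1 hx
    exact Submodule.sum_mem _ fun k _ => mul_mem_of_mem_shiftedPart 𝒜 (hg k) (hF k)
  have hIfin : ∀ m, FiniteDimensional K (I m) := fun m =>
    Submodule.finiteDimensional_of_le (hIle m)
  have hbot : ∀ {e m : ℕ}, m < e → Module.finrank K (shiftedPart 𝒜 e m) = 0 := by
    intro e m h
    rw [shiftedPart_of_lt 𝒜 h, finrank_bot]
  have hself : ∀ e, Module.finrank K (shiftedPart 𝒜 e e) = 1 := by
    intro e
    rw [shiftedPart_self, h1]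
  have hlow : ∀ k, d k < p → F k = 0 := by
    intro k hk
    have h := hdim (d k)
    rw [hbot (by omega), hbot (by omega), hbot (by omega)] at h
    have h2 : I (d k) = ⊥ := Submodule.finrank_eq_zero.1 (by omega)
    have := hFI k
    rwa [h2] at this
  -- `I` vanishes below degree `p` and is nonzero in degree `p < δ`, so a generator of degree
  -- exactly `p` has to be nonzero.
  obtain ⟨a, hda, hFa⟩ : ∃ a, d a = p ∧ F a ≠ 0 := by
    by_contra! hcon
    have h2 : I p = ⊥ := by
      rw [eq_bot_iff]
      intro x hx
      obtain ⟨g, hg, rfl⟩ := (hI _ _).1 hx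
      refine Submodule.sum_mem _ fun k _ => ?_
      rcases lt_trichotomy (d k) p with h | h | h
      · rw [hlow k h, mul_zero]; exact zero_mem _
      · rw [hcon k h, mul_zero]; exact zero_mem _
      · have := hg k
        rw [shiftedPart_of_lt 𝒜 h] at this
        rw [show g k = 0 from this, zero_mul]; exact zero_mem _
    have h := hdim p
    rw [h2, finrank_bot, hbot (show p < δ by omega), hself] at h
    omega
  let G : ℕ → Submodule K R := fun m => (shiftedPart 𝒜 p m).map (LinearMap.mulRight K (F a))
  have hG : ∀ m x, x ∈ G m ↔ ∃ g ∈ shiftedPart 𝒜 p m, g * F a = x := fun m x => Iff.rfl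
  have hGfin : ∀ m, Module.finrank K (G m) = Module.finrank K (shiftedPart 𝒜 p m) := by
    intro m
    exact (Submodule.equivMapOfInjective (LinearMap.mulRight K (F a))
      (mul_left_injective₀ hFa) _).finrank_eq.symm
  have hGI : ∀ m, G m ≤ I m := by
    rintro m _ ⟨g, hg, rfl⟩
    exact hmemI (hda ▸ hg)
  -- Below `q` only the term of `p` survives in the Hilbert function, so `I` is there the principal
  -- ideal of `F a`. In degree `q` exactly one new dimension appears, because `q < δ`.
  have hGeq : ∀ m, m < q → G m = I m := by
    intro m hm
    apply Submodule.eq_of_le_of_finrank_eq (hGI m)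
    have h := hdim m
    rw [hbot (show m < δ by omega), hbot hm] at h
    rw [hGfin]; omega
  have hIq : Module.finrank K (I q) = Module.finrank K (G q) + 1 := by
    have h := hdim q
    rw [hbot hqδ, hself] at h
    rw [hGfin]; omega
  have hmulG : ∀ {k m g}, g ∈ shiftedPart 𝒜 (d k) m → F k ∈ G (d k) → g * F k ∈ G m := by
    intro k m g hg hk
    obtain ⟨x, hx, hxk⟩ := (hG _ _).1 hk
    exact (hG _ _).2 ⟨g * x, mul_mem_shiftedPart 𝒜 hg hx, by rw [mul_assoc, hxk]⟩
  obtain ⟨c, hdc, hFcG⟩ : ∃ c, d c = q ∧ F c ∉ G q := by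
    by_contra! hcon
    have hle : I q ≤ G q := by
      intro x hx
      obtain ⟨g, hg, rfl⟩ := (hI _ _).1 hx
      refine Submodule.sum_mem _ fun k _ => hmulG (hg k) ?_
      rcases (hd k).lt_or_eq with h | h
      · rw [hGeq _ h]; exact hFI k
      · rw [h]; exact hcon k h
    have := Submodule.finrank_mono hle
    omega
  have hFc : F c ≠ 0 := fun h => hFcG (h ▸ zero_mem _)
  -- This needs an argument only because `p = q` is allowed.
  have hac : a ≠ c := by
    rintro rfl
    refine hFcG ((hG _ _).2 ⟨1, ?_, one_mul _⟩)
    rw [← hda, hdc, shiftedPart_self]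
    exact hone
  have htop : G q ⊔ K ∙ F c = I q := by
    have hle : G q ⊔ K ∙ F c ≤ I q :=
      sup_le (hGI q) ((Submodule.span_singleton_le_iff_mem _ _).2 (hdc ▸ hFI c))
    apply Submodule.eq_of_le_of_finrank_le hle
    rw [hIq]
    have : FiniteDimensional K ↥(G q ⊔ K ∙ F c) := Submodule.finiteDimensional_of_le hle
    apply Submodule.finrank_lt_finrank_of_lt
    refine lt_of_le_of_ne le_sup_left fun h => hFcG ?_
    rw [h]
    exact Submodule.mem_sup_right (Submodule.mem_span_singleton_self _)
  have hgen : ∀ k, ∃ x ∈ shiftedPart 𝒜 p (d k), ∃ y ∈ shiftedPart 𝒜 q (d k),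
      F k = x * F a + y * F c := by
    intro k
    rcases (hd k).lt_or_eq with h | h
    · have := hFI k
      rw [← hGeq _ h] at this
      obtain ⟨x, hx, hxk⟩ := (hG _ _).1 this
      exact ⟨x, hx, 0, zero_mem _, by rw [hxk, zero_mul, add_zero]⟩
    · have := hFI k
      rw [h, ← htop] at this
      obtain ⟨z, hz, w, hw, hzw⟩ := Submodule.mem_sup.1 this
      obtain ⟨x, hx, rfl⟩ := (hG _ _).1 hz
      obtain ⟨t, rfl⟩ := Submodule.mem_span_singleton.1 hw
      refine ⟨x, h ▸ hx, t • 1, ?_, ?_⟩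
      · rw [h, shiftedPart_self]; exact Submodule.smul_mem _ _ hone
      · rw [← hzw, smul_mul_assoc, one_mul]
  refine ⟨a, c, hac, hda, hdc, hFa, hFc, hgen, ?_⟩
  have hfa : f a ≠ 0 := fun h => hFa (by rw [hf, h, mul_zero])
  have hfc : f c ≠ 0 := fun h => hFc (by rw [hf, h, mul_zero])
  -- In degree `m`, the pairs `(x, y)` map onto at least `I m`, so the syzygies have at most the
  -- dimension of the part of degree `m` of `R[-δ]`. The trivial syzygies `t * (f c, -f a)` already
  -- have that dimension.
  have hsyz : ∀ m, ∀ x ∈ shiftedPart 𝒜 p m, ∀ y ∈ shiftedPart 𝒜 q m, x * F a + y * F c = 0 →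
      f c ∣ x := by
    intro m x hx y hy hxy
    let Φ : (shiftedPart 𝒜 p m × shiftedPart 𝒜 q m) →ₗ[K] R :=
      ((LinearMap.mulRight K (F a)) ∘ₗ (shiftedPart 𝒜 p m).subtype).coprod
        ((LinearMap.mulRight K (F c)) ∘ₗ (shiftedPart 𝒜 q m).subtype)
    have hΦ : ∀ z, Φ z = (z.1 : R) * F a + (z.2 : R) * F c := fun z => rfl
    have hrange : I m ≤ LinearMap.range Φ := by
      intro x hx
      obtain ⟨g, hg, rfl⟩ := (hI _ _).1 hx
      refine Submodule.sum_mem _ fun k _ => ?_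
      obtain ⟨x, hx, y, hy, hk⟩ := hgen k
      refine ⟨(⟨g k * x, mul_mem_shiftedPart 𝒜 (hg k) hx⟩,
        ⟨g k * y, mul_mem_shiftedPart 𝒜 (hg k) hy⟩), ?_⟩
      rw [hΦ, hk]
      ring
    have hker : Module.finrank K (LinearMap.ker Φ) ≤ Module.finrank K (shiftedPart 𝒜 δ m) := by
      have e1 := LinearMap.finrank_range_add_finrank_ker Φ
      have e2 := Submodule.finrank_mono hrange
      have e3 := hdim m
      rw [Module.finrank_prod] at e1
      omega
    -- `f c` has degree `q - b`, and `(q - b) + p = δ`; likewise for `f a` with `p` and `q`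
    -- exchanged.
    have hfmem1 : f c ∈ shiftedPart 𝒜 p δ := by
      have hb := le_of_mem_shiftedPart 𝒜 (hfmem c) hfc
      exact mem_shiftedPart 𝒜
        (mem_of_mem_shiftedPart 𝒜 (hfmem c) (j := q - b) (by omega)) (by omega)
    have hfmem2 : f a ∈ shiftedPart 𝒜 q δ := by
      have hb := le_of_mem_shiftedPart 𝒜 (hfmem a) hfa
      exact mem_shiftedPart 𝒜
        (mem_of_mem_shiftedPart 𝒜 (hfmem a) (j := p - b) (by omega)) (by omega)
    let Ψ : shiftedPart 𝒜 δ m →ₗ[K] shiftedPart 𝒜 p m × shiftedPart 𝒜 q m :=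
      ((((LinearMap.mulRight K (f c)) ∘ₗ (shiftedPart 𝒜 δ m).subtype).codRestrict
          (shiftedPart 𝒜 p m) fun t => mul_mem_shiftedPart 𝒜 t.2 hfmem1).prod
        ((-(LinearMap.mulRight K (f a)) ∘ₗ (shiftedPart 𝒜 δ m).subtype).codRestrict
          (shiftedPart 𝒜 q m) fun t => neg_mem (mul_mem_shiftedPart 𝒜 t.2 hfmem2)))
    have hΨ : ∀ t, ((Ψ t).1 : R) = t * f c := fun t => rfl
    have hinj : Function.Injective Ψ := by
      intro t t' h
      have : (t : R) * f c = t' * f c := by rw [← hΨ, ← hΨ, h]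
      exact Subtype.ext (mul_right_cancel₀ hfc this)
    have hcomp : ∀ t, Φ (Ψ t) = 0 := by
      intro t
      rw [hΦ]
      change (t : R) * f c * F a + -((t : R) * f a) * F c = 0
      rw [hf a, hf c]
      ring
    obtain ⟨t, ht⟩ := exists_of_finrank_ker_le hinj hcomp hker (y := (⟨x, hx⟩, ⟨y, hy⟩)) hxy
    refine ⟨t, ?_⟩
    rw [mul_comm, ← hΨ, ht]
  intro x y hxy
  -- An arbitrary syzygy is split into homogeneous ones; since `F a` and `F c` have different
  -- degrees, the components of `x` and `y` are taken with different shifts.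
  have hdvd : f c ∣ x := by
    apply dvd_of_forall_dvd_decompose 𝒜
    intro j
    rw [← shiftedComponent_add 𝒜 p j x]
    refine hsyz _ _ (shiftedComponent_mem 𝒜 _ _ _) (shiftedComponent 𝒜 q (j + p) y)
      (shiftedComponent_mem 𝒜 _ _ _) ?_
    rw [← decompose_mul_of_mem 𝒜 _ _ (hda ▸ hF a), ← decompose_mul_of_mem 𝒜 _ _ (hdc ▸ hF c),
      ← Submodule.coe_add, ← DirectSum.add_apply, ← DirectSum.decompose_add, hxy]
    simp
  obtain ⟨t, rfl⟩ := hdvd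
  refine ⟨t, mul_comm _ _, ?_⟩
  rw [hf a, hf c] at hxy
  have : B * f c * (t * f a + y) = 0 := by rw [← hxy]; ring
  rcases mul_eq_zero.1 this with h | h
  · exact absurd h (mul_ne_zero hB0 hfc)
  · linear_combination h

end Graded

end HypArrangement

namespace HypArrangement

theorem finrank_map_add_of_ker {K X Y : Type*} [Field K] [AddCommGroup X] [Module K X]
    [AddCommGroup Y] [Module K Y] (f : X →ₗ[K] Y) {M N : Submodule K X} [FiniteDimensional K N]
    (hMN : M ≤ N) (h : ∀ x ∈ N, f x = 0 ↔ x ∈ M) :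
    Module.finrank K (N.map f) + Module.finrank K M = Module.finrank K N := by
  have h1 := LinearMap.finrank_range_add_finrank_ker (f.domRestrict N)
  have h2 : LinearMap.ker (f.domRestrict N) = M.comap N.subtype := by
    ext x
    exact h x x.2
  rw [LinearMap.range_domRestrict, h2,
    (Submodule.comapSubtypeEquivOfLe hMN).finrank_eq] at h1
  exact h1

variable {K V : Type*} [Field K] [AddCommGroup V] [Module K V]

/-! ### Graded parts of modules of derivations -/

/-- The space of derivations that are homogeneous of degree `m`. -/
def homogeneousDer (K V : Type*) [Field K] [AddCommGroup V] [Module K V] (m : ℕ) :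
    Submodule K (Derivation K (CoordRing K V) (CoordRing K V)) where
  carrier := {θ | IsHomogeneousOfDegree θ m}
  zero_mem' := fun γ => by simp
  add_mem' := fun {θ η} hθ hη γ => by
    rw [Derivation.add_apply]
    exact add_mem (hθ γ) (hη γ)
  smul_mem' := fun c θ hθ γ => by
    rw [Derivation.smul_apply]
    exact Submodule.smul_mem _ c (hθ γ)

/-- The homogeneous part of degree `m` of a module of derivations. -/
def gradedPart (N : Submodule (CoordRing K V) (Derivation K (CoordRing K V) (CoordRing K V)))
    (m : ℕ) : Submodule K (Derivation K (CoordRing K V) (CoordRing K V)) :=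
  homogeneousDer K V m ⊓ N.restrictScalars K

theorem mem_gradedPart
    {N : Submodule (CoordRing K V) (Derivation K (CoordRing K V) (CoordRing K V))} {m : ℕ}
    {θ : Derivation K (CoordRing K V) (CoordRing K V)} :
    θ ∈ gradedPart N m ↔ IsHomogeneousOfDegree θ m ∧ θ ∈ N := Iff.rfl

theorem sum_smul_apply {ι : Type*} [Fintype ι]
    (g : ι → CoordRing K V) (φ : ι → Derivation K (CoordRing K V) (CoordRing K V))
    (x : CoordRing K V) : (∑ k, g k • φ k) x = ∑ k, g k * φ k x := by
  classical
  induction (Finset.univ : Finset ι) using Finset.induction_on with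
  | empty => simp
  | insert k s hk ih =>
    rw [Finset.sum_insert hk, Finset.sum_insert hk, Derivation.add_apply, ih]
    rfl

theorem sum_add_smul {ι : Type*} [Fintype ι] (u w : ι → CoordRing K V)
    (φ : ι → Derivation K (CoordRing K V) (CoordRing K V)) :
    ∑ k, (u k + w k) • φ k = ∑ k, u k • φ k + ∑ k, w k • φ k := by
  apply derivation_ext
  intro γ
  rw [Derivation.add_apply, sum_smul_apply, sum_smul_apply, sum_smul_apply,
    ← Finset.sum_add_distrib]
  exact Finset.sum_congr rfl fun k _ => add_mul _ _ _

theorem sum_sub_smul {ι : Type*} [Fintype ι] (u w : ι → CoordRing K V)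
    (φ : ι → Derivation K (CoordRing K V) (CoordRing K V)) :
    ∑ k, (u k - w k) • φ k = ∑ k, u k • φ k - ∑ k, w k • φ k := by
  apply derivation_ext
  intro γ
  rw [Derivation.sub_apply, sum_smul_apply, sum_smul_apply, sum_smul_apply,
    ← Finset.sum_sub_distrib]
  exact Finset.sum_congr rfl fun k _ => sub_mul _ _ _

theorem sum_mul_smul {ι : Type*} [Fintype ι] (s : CoordRing K V) (u : ι → CoordRing K V)
    (φ : ι → Derivation K (CoordRing K V) (CoordRing K V)) :
    ∑ k, (s * u k) • φ k = s • ∑ k, u k • φ k := by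
  rw [Finset.smul_sum]
  exact Finset.sum_congr rfl fun k _ => mul_smul _ _ _

theorem sum_ite_smul {ι : Type*} [Fintype ι] [DecidableEq ι] (a : ι) (t : CoordRing K V)
    (φ : ι → Derivation K (CoordRing K V) (CoordRing K V)) :
    ∑ k, (if k = a then t else 0) • φ k = t • φ a := by
  rw [Finset.sum_eq_single a]
  · rw [if_pos rfl]
  · intro k _ hk
    rw [if_neg hk, zero_smul]
  · exact fun h => absurd (Finset.mem_univ a) h

theorem derivation_sub_smul (x y : CoordRing K V)
    (θ : Derivation K (CoordRing K V) (CoordRing K V)) : (x - y) • θ = x • θ - y • θ :=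
  sub_smul x y θ

theorem derivation_neg_smul (x : CoordRing K V)
    (θ : Derivation K (CoordRing K V) (CoordRing K V)) : (-x) • θ = -(x • θ) :=
  neg_smul x θ

theorem isHomogeneousOfDegree_smul {θ : Derivation K (CoordRing K V) (CoordRing K V)} {e m : ℕ}
    (hθ : IsHomogeneousOfDegree θ e) {g : CoordRing K V}
    (hg : g ∈ shiftedPart (homogeneousPart K V) e m) : IsHomogeneousOfDegree (g • θ) m :=
  fun γ => mul_mem_of_mem_shiftedPart _ hg (hθ γ)

section Family

variable {ι : Type*} [Fintype ι] {φ : ι → Derivation K (CoordRing K V) (CoordRing K V)}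
  {e : ι → ℕ}

/-- The combinations of a family of homogeneous derivations that are homogeneous of
degree `m`. -/
noncomputable def combination (φ : ι → Derivation K (CoordRing K V) (CoordRing K V))
    (e : ι → ℕ) (m : ℕ) :
    (∀ k, shiftedPart (homogeneousPart K V) (e k) m) →ₗ[K]
      Derivation K (CoordRing K V) (CoordRing K V) where
  toFun g := ∑ k, (g k : CoordRing K V) • φ k
  map_add' g h := by
    rw [← Finset.sum_add_distrib]
    exact Finset.sum_congr rfl fun k _ => add_smul _ _ _
  map_smul' c g := by
    rw [RingHom.id_apply, Finset.smul_sum]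
    exact Finset.sum_congr rfl fun k _ => smul_assoc _ _ _

theorem combination_apply (m : ℕ) (g : ∀ k, shiftedPart (homogeneousPart K V) (e k) m) :
    combination φ e m g = ∑ k, (g k : CoordRing K V) • φ k := rfl

/-- A homogeneous combination of homogeneous derivations is unchanged when each coefficient is
replaced by its component of the fitting degree. -/
theorem range_combination (hφ : ∀ k, IsHomogeneousOfDegree (φ k) (e k))
    {N : Submodule (CoordRing K V) (Derivation K (CoordRing K V) (CoordRing K V))}
    (hN : ∀ θ, θ ∈ N ↔ ∃ g : ι → CoordRing K V, θ = ∑ k, g k • φ k) (m : ℕ) :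
    LinearMap.range (combination φ e m) = gradedPart N m := by
  ext θ
  rw [mem_gradedPart, LinearMap.mem_range]
  constructor
  · rintro ⟨g, rfl⟩
    refine ⟨?_, (hN _).2 ⟨fun k => g k, rfl⟩⟩
    exact Submodule.sum_mem (homogeneousDer K V m) fun k _ =>
      isHomogeneousOfDegree_smul (hφ k) (g k).2
  · rintro ⟨hθ, hθN⟩
    obtain ⟨g, rfl⟩ := (hN _).1 hθN
    refine ⟨fun k => ⟨shiftedComponent (homogeneousPart K V) (e k) m (g k),
      shiftedComponent_mem _ _ _ _⟩, ?_⟩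
    apply derivation_ext
    intro γ
    rw [combination_apply, ← DirectSum.decompose_of_mem_same (homogeneousPart K V) (hθ γ),
      sum_smul_apply, sum_smul_apply, DirectSum.decompose_sum, DFinsupp.finsetSum_apply,
      AddSubmonoidClass.coe_finsetSum]
    exact Finset.sum_congr rfl fun k _ => (decompose_mul_of_mem _ m (g k) (hφ k γ)).symm

variable [FiniteDimensional K V]

theorem finrank_gradedPart_of_linearIndependent (hφ : ∀ k, IsHomogeneousOfDegree (φ k) (e k))
    {N : Submodule (CoordRing K V) (Derivation K (CoordRing K V) (CoordRing K V))}
    (hN : ∀ θ, θ ∈ N ↔ ∃ g : ι → CoordRing K V, θ = ∑ k, g k • φ k)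
    (hli : ∀ g : ι → CoordRing K V, ∑ k, g k • φ k = 0 → ∀ k, g k = 0) (m : ℕ) :
    Module.finrank K (gradedPart N m) =
      ∑ k, Module.finrank K (shiftedPart (homogeneousPart K V) (e k) m) := by
  rw [← range_combination hφ hN, LinearMap.finrank_range_of_inj, Module.finrank_pi_fintype]
  rw [injective_iff_map_eq_zero]
  intro g hg
  funext k
  exact Subtype.ext (hli (fun k => g k) hg k)

theorem finiteDimensional_gradedPart (hφ : ∀ k, IsHomogeneousOfDegree (φ k) (e k))
    {N : Submodule (CoordRing K V) (Derivation K (CoordRing K V) (CoordRing K V))}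
    (hN : ∀ θ, θ ∈ N ↔ ∃ g : ι → CoordRing K V, θ = ∑ k, g k • φ k) (m : ℕ) :
    FiniteDimensional K (gradedPart N m) := by
  rw [← range_combination hφ hN]
  infer_instance

/-- Rank-nullity in degree `m` for the resolution `0 → S[-D] → ⨁ S[-e k] → N → 0` whose first map is
given by the relation `w`. -/
theorem finrank_gradedPart_of_relation (hφ : ∀ k, IsHomogeneousOfDegree (φ k) (e k))
    {N : Submodule (CoordRing K V) (Derivation K (CoordRing K V) (CoordRing K V))}
    (hN : ∀ θ, θ ∈ N ↔ ∃ g : ι → CoordRing K V, θ = ∑ k, g k • φ k)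
    {w : ι → CoordRing K V} {D : ℕ} (hw : ∀ k, w k ∈ shiftedPart (homogeneousPart K V) (e k) D)
    (hw0 : w ≠ 0)
    (hrel : ∀ g : ι → CoordRing K V, ∑ k, g k • φ k = 0 ↔ ∃ t, ∀ k, g k = t * w k) (m : ℕ) :
    Module.finrank K (gradedPart N m) +
      Module.finrank K (shiftedPart (homogeneousPart K V) D m) =
      ∑ k, Module.finrank K (shiftedPart (homogeneousPart K V) (e k) m) := by
  obtain ⟨k₀, hk₀⟩ : ∃ k, w k ≠ 0 := by
    by_contra! h
    exact hw0 (funext h)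
  let Ψ : shiftedPart (homogeneousPart K V) D m →ₗ[K]
      (∀ k, shiftedPart (homogeneousPart K V) (e k) m) :=
    LinearMap.pi fun k => ((LinearMap.mulRight K (w k)) ∘ₗ
      (shiftedPart (homogeneousPart K V) D m).subtype).codRestrict _
        fun t => mul_mem_shiftedPart _ t.2 (hw k)
  have hΨ : ∀ t k, (Ψ t k : CoordRing K V) = t * w k := fun t k => rfl
  have hinj : Function.Injective Ψ := by
    intro t t' h
    have : (t : CoordRing K V) * w k₀ = t' * w k₀ := by rw [← hΨ, ← hΨ, h]
    exact Subtype.ext (mul_right_cancel₀ hk₀ this)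
  have hker : LinearMap.range Ψ = LinearMap.ker (combination φ e m) := by
    ext g
    rw [LinearMap.mem_ker, combination_apply, hrel fun k => g k]
    constructor
    · rintro ⟨t, rfl⟩
      exact ⟨t, fun k => rfl⟩
    · rintro ⟨t, ht⟩
      -- A multiplier is itself homogeneous, because its product with the nonzero homogeneous entry
      -- `w k₀` is.
      have htm : t ∈ shiftedPart (homogeneousPart K V) D m := by
        obtain ⟨j, hj, hwj⟩ := (mem_shiftedPart_cases _ (hw k₀)).resolve_left hk₀
        have hg := (g k₀).2
        rw [ht k₀] at hg
        rcases mem_shiftedPart_cases _ hg with h0 | ⟨i, hi, hti⟩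
        · rw [(mul_eq_zero.1 h0).resolve_right hk₀]
          exact zero_mem _
        · rcases mem_shiftedPart_cases _ (mem_shiftedPart_of_mul_mem _ hwj hk₀ hti) with
            rfl | ⟨l, hl, htl⟩
          · exact zero_mem _
          · exact mem_shiftedPart _ htl (by omega)
      exact ⟨⟨t, htm⟩, funext fun k => Subtype.ext (ht k).symm⟩
  have h := LinearMap.finrank_range_add_finrank_ker (combination φ e m)
  rw [range_combination hφ hN, ← hker, LinearMap.finrank_range_of_inj hinj,
    Module.finrank_pi_fintype] at h
  exact h

end Family

/-! ### Reduction modulo a linear form -/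

section Hyperplane

variable {H : Submodule K V} {α : Module.Dual K V}

theorem exists_homogeneous_lift (hα : LinearMap.ker α = H) (h0 : α ≠ 0) {m : ℕ}
    {x : CoordRing K H} (hx : x ∈ homogeneousPart K H m) :
    ∃ y ∈ homogeneousPart K V m, pullback H.subtype y = x := by
  obtain ⟨v, hv⟩ := exists_apply_eq_one h0
  exact ⟨pullback (hyperProj hα hv) x, pullback_mem _ hx, pullback_pullback hα hv x⟩

theorem exists_shifted_lift (hα : LinearMap.ker α = H) (h0 : α ≠ 0) {e m : ℕ}
    {x : CoordRing K H} (hx : x ∈ shiftedPart (homogeneousPart K H) e m) :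
    ∃ y ∈ shiftedPart (homogeneousPart K V) e m, pullback H.subtype y = x := by
  rcases mem_shiftedPart_cases _ hx with rfl | ⟨j, hj, hx⟩
  · exact ⟨0, zero_mem _, map_zero _⟩
  · obtain ⟨y, hy, h⟩ := exists_homogeneous_lift hα h0 hx
    exact ⟨y, mem_shiftedPart _ hy hj, h⟩

theorem pullback_subtype_surjective (hα : LinearMap.ker α = H) (h0 : α ≠ 0) :
    Function.Surjective (pullback H.subtype) := by
  obtain ⟨v, hv⟩ := exists_apply_eq_one h0
  exact fun x => ⟨_, pullback_pullback hα hv x⟩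

theorem pullback_mem_shiftedPart {e m : ℕ} {x : CoordRing K V}
    (hx : x ∈ shiftedPart (homogeneousPart K V) e m) :
    pullback H.subtype x ∈ shiftedPart (homogeneousPart K H) e m := by
  rcases mem_shiftedPart_cases _ hx with rfl | ⟨j, hj, hx⟩
  · rw [map_zero]; exact zero_mem _
  · exact mem_shiftedPart _ (pullback_mem _ hx) hj

/-- Dimension count in the exact sequence `0 → S[-1] → S → S_H → 0`, with multiplication by `α` as
first map. -/
theorem finrank_homogeneousPart_hyperplane [FiniteDimensional K V] (hα : LinearMap.ker α = H)
    (h0 : α ≠ 0) (m : ℕ) :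
    Module.finrank K (homogeneousPart K H m) +
      Module.finrank K (shiftedPart (homogeneousPart K V) 1 m) =
      Module.finrank K (homogeneousPart K V m) := by
  have hα0 : form α ≠ 0 := (prime_form h0).ne_zero
  have hmap : (homogeneousPart K V m).map (pullback H.subtype).toLinearMap =
      homogeneousPart K H m := by
    apply le_antisymm
    · rintro _ ⟨x, hx, rfl⟩
      exact pullback_mem _ hx
    · intro x hx
      exact exists_homogeneous_lift hα h0 hx
  let M := (shiftedPart (homogeneousPart K V) 1 m).map (LinearMap.mulRight K (form α))
  have hM : Module.finrank K M = Module.finrank K (shiftedPart (homogeneousPart K V) 1 m) :=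
    (Submodule.equivMapOfInjective (LinearMap.mulRight K (form α))
      (mul_left_injective₀ hα0) _).finrank_eq.symm
  rw [← hmap, ← hM]
  apply finrank_map_add_of_ker
  · rintro _ ⟨x, hx, rfl⟩
    exact mul_mem_of_mem_shiftedPart _ hx (form_mem α)
  · intro x hx
    change pullback H.subtype x = 0 ↔ _
    rw [pullback_subtype_eq_zero_iff hα h0]
    constructor
    · rintro ⟨y, rfl⟩
      rw [mul_comm] at hx ⊢
      exact ⟨y, mem_shiftedPart_of_mul_mem _ (form_mem α) hα0 hx, rfl⟩
    · rintro ⟨y, -, rfl⟩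
      exact ⟨y, mul_comm _ _⟩

theorem finrank_shiftedPart_hyperplane [FiniteDimensional K V] (hα : LinearMap.ker α = H)
    (h0 : α ≠ 0) (e m : ℕ) :
    Module.finrank K (shiftedPart (homogeneousPart K H) e m) +
      Module.finrank K (shiftedPart (homogeneousPart K V) (e + 1) m) =
      Module.finrank K (shiftedPart (homogeneousPart K V) e m) := by
  by_cases h : e ≤ m
  · have hshift : shiftedPart (homogeneousPart K V) (e + 1) m =
        shiftedPart (homogeneousPart K V) 1 (m - e) := by
      by_cases h1 : e + 1 ≤ m
      · rw [shiftedPart_of_le _ h1, shiftedPart_of_le _ (by omega), Nat.sub_add_eq]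
      · rw [shiftedPart_of_lt _ (by omega), shiftedPart_of_lt _ (by omega)]
    rw [hshift, shiftedPart_of_le _ h, shiftedPart_of_le _ h,
      ← finrank_homogeneousPart_hyperplane hα h0]
  · rw [shiftedPart_of_lt _ (by omega), shiftedPart_of_lt _ (by omega),
      shiftedPart_of_lt _ (by omega), finrank_bot, finrank_bot]

end Hyperplane

end HypArrangement

/-! ### Divisibility and equations of hyperplanes -/

namespace HypArrangement

/-- The prime factors of `a` are cancelled one at a time: each `p` misses some `b j`, hence divides
`w`. -/
theorem dvd_of_forall_dvd_mul {R J : Type*} [CommRing R] [IsDomain R]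
    [UniqueFactorizationMonoid R] {b : J → R} (hb : ∀ p, Prime p → ∃ j, ¬ p ∣ b j) {a : R}
    (ha : a ≠ 0) {w : R} (h : ∀ j, a ∣ b j * w) : a ∣ w := by
  induction a using UniqueFactorizationMonoid.induction_on_prime generalizing w with
  | h₁ => exact absurd rfl ha
  | h₂ x hx => exact hx.dvd
  | h₃ a p ha0 hp ih =>
    obtain ⟨j, hj⟩ := hb p hp
    obtain ⟨w, rfl⟩ := (hp.dvd_or_dvd ((Dvd.intro _ rfl).trans (h j))).resolve_left hj
    refine mul_dvd_mul_left p (ih ha0 fun j => ?_)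
    have := h j
    rw [mul_left_comm] at this
    exact (mul_dvd_mul_iff_left hp.ne_zero).1 this

variable {K V : Type*} [Field K] [AddCommGroup V] [Module K V]

/-- A linear form with kernel `L`, if there is one. -/
noncomputable def equation (L : Submodule K V) : Module.Dual K V :=
  open Classical in if h : ∃ γ : Module.Dual K V, LinearMap.ker γ = L then h.choose else 0

theorem ker_equation {L : Submodule K V} (hL : IsCoatom L) : LinearMap.ker (equation L) = L := by
  have h := exists_ker_eq hL
  rw [equation, dif_pos h]
  exact h.choose_spec

theorem equation_ne_zero {L : Submodule K V} (hL : IsCoatom L) : equation L ≠ 0 :=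
  ne_zero_of_isCoatom_ker (by rwa [ker_equation hL])

theorem ker_comp_subtype (H : Submodule K V) (γ : Module.Dual K V) :
    LinearMap.ker (γ ∘ₗ H.subtype) = (LinearMap.ker γ).comap H.subtype :=
  LinearMap.ker_comp _ _

/-! ### Logarithmic derivations of a deletion and of a restriction -/

variable {A : HypArrangement K V} {H : Submodule K V} {α : Module.Dual K V} {v : V}

theorem mem_logDer_iff (hH : H ∈ A.hyperplanes) (hα : LinearMap.ker α = H)
    {θ : Derivation K (CoordRing K V) (CoordRing K V)} :
    θ ∈ A.logDer ↔ θ ∈ (A.deletion H).logDer ∧ form α ∣ θ (form α) := by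
  constructor
  · exact fun h => ⟨fun γ hγ => h γ hγ.1, h α (by rwa [hα])⟩
  · rintro ⟨h1, h2⟩ γ hγ
    by_cases hγH : LinearMap.ker γ = H
    · exact form_dvd_of_ker_eq (hα.trans hγH.symm)
        (ne_zero_of_isCoatom_ker (A.isCoatom _ hγ)) h2
    · exact h1 γ ⟨hγ, hγH⟩

theorem exists_eq_smul {α : Module.Dual K V} (h0 : α ≠ 0) {θ : Derivation K (CoordRing K V) (CoordRing K V)}
    (h : ∀ γ, form α ∣ θ (form γ)) : ∃ η, θ = form α • η := by
  choose g hg using h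
  have hα0 : form α ≠ 0 := (prime_form h0).ne_zero
  let g' : Module.Dual K V →ₗ[K] CoordRing K V :=
    { toFun := g
      map_add' := fun γ γ' => mul_left_cancel₀ hα0 (by
        rw [mul_add, ← hg, ← hg, ← hg, ← map_add]
        exact congrArg θ (map_add _ _ _))
      map_smul' := fun c γ => mul_left_cancel₀ hα0 (by
        rw [← hg, form_smul, Derivation.map_smul, hg, RingHom.id_apply, mul_smul_comm]) }
  refine ⟨derivationOf g', derivation_ext fun γ => ?_⟩
  rw [Derivation.smul_apply, derivationOf_form, hg]
  rfl

/-- The restriction of a derivation to the hyperplane `H`. -/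
noncomputable def restrictDer (hα : LinearMap.ker α = H) (hv : α v = 1) :
    Derivation K (CoordRing K V) (CoordRing K V) →ₗ[K]
      Derivation K (CoordRing K H) (CoordRing K H) where
  toFun θ := derivationOf ((pullback H.subtype).toLinearMap ∘ₗ θ.toLinearMap ∘ₗ
    (pullback (hyperProj hα hv)).toLinearMap ∘ₗ SymmetricAlgebra.ι K (Module.Dual K H))
  map_add' θ η := derivation_ext fun γ => by
    rw [Derivation.add_apply]
    simp only [derivationOf_form]
    exact map_add (pullback H.subtype) _ _
  map_smul' c θ := derivation_ext fun γ => by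
    rw [Derivation.smul_apply]
    simp only [derivationOf_form]
    exact map_smul (pullback H.subtype) c _

theorem restrictDer_form (hα : LinearMap.ker α = H) (hv : α v = 1)
    (θ : Derivation K (CoordRing K V) (CoordRing K V)) (γ : Module.Dual K H) :
    restrictDer hα hv θ (form γ) = pullback H.subtype (θ (form (γ ∘ₗ hyperProj hα hv))) := by
  change derivationOf _ (form γ) = _
  rw [derivationOf_form, ← pullback_form]
  rfl

theorem restrictDer_smul (hα : LinearMap.ker α = H) (hv : α v = 1) (g : CoordRing K V)
    (θ : Derivation K (CoordRing K V) (CoordRing K V)) :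
    restrictDer hα hv (g • θ) = pullback H.subtype g • restrictDer hα hv θ := by
  apply derivation_ext
  intro γ
  rw [restrictDer_form, Derivation.smul_apply, Derivation.smul_apply, restrictDer_form,
    smul_eq_mul, smul_eq_mul, map_mul]

theorem restrictDer_sum {ι : Type*} [Fintype ι] (hα : LinearMap.ker α = H) (hv : α v = 1)
    (g : ι → CoordRing K V) (φ : ι → Derivation K (CoordRing K V) (CoordRing K V)) :
    restrictDer hα hv (∑ k, g k • φ k) =
      ∑ k, pullback H.subtype (g k) • restrictDer hα hv (φ k) := by
  rw [map_sum]
  exact Finset.sum_congr rfl fun k _ => restrictDer_smul hα hv _ _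

theorem isHomogeneousOfDegree_restrictDer (hα : LinearMap.ker α = H) (hv : α v = 1)
    {θ : Derivation K (CoordRing K V) (CoordRing K V)} {m : ℕ} (hθ : IsHomogeneousOfDegree θ m) :
    IsHomogeneousOfDegree (restrictDer hα hv θ) m := fun γ => by
  rw [restrictDer_form]
  exact pullback_mem _ (hθ _)

/-- If `θ` preserves the ideal `(α)`, it descends to `S/(α)`, so the choice of `v` in the
restriction does not matter. -/
theorem restrictDer_form_comp (hα : LinearMap.ker α = H) (hv : α v = 1)
    {θ : Derivation K (CoordRing K V) (CoordRing K V)} (h : form α ∣ θ (form α))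
    (γ : Module.Dual K V) :
    restrictDer hα hv θ (form (γ ∘ₗ H.subtype)) = pullback H.subtype (θ (form γ)) := by
  obtain ⟨y, hy⟩ := h
  rw [restrictDer_form]
  conv_rhs => rw [form_eq_add hα hv γ]
  rw [map_add, Derivation.map_smul, hy, map_add, map_smul, map_mul, pullback_subtype_form hα,
    zero_mul, smul_zero, add_zero]

theorem restrictDer_mem (hH : H ∈ A.hyperplanes) (hα : LinearMap.ker α = H) (hv : α v = 1)
    {θ : Derivation K (CoordRing K V) (CoordRing K V)} (hθ : θ ∈ A.logDer) :
    restrictDer hα hv θ ∈ (A.restriction H hH).logDer := by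
  intro γ hγ
  have hγ0 := ne_zero_of_isCoatom_ker ((A.restriction H hH).isCoatom _ hγ)
  obtain ⟨L, hL, hLγ⟩ := hγ
  have hker := ker_equation (A.isCoatom L hL.1)
  have hk2 : LinearMap.ker (equation L ∘ₗ H.subtype) = LinearMap.ker γ := by
    rw [ker_comp_subtype, hker]
    exact hLγ
  refine form_dvd_of_ker_eq hk2 hγ0 ?_
  rw [restrictDer_form_comp hα hv (hθ α (by rwa [hα])), ← pullback_form]
  exact map_dvd _ (hθ _ (by rw [hker]; exact hL.1))

/-- Exactness of `D(A') → D(A) → D(A^H)` in the middle, with multiplication by `α` first. If the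
restriction vanishes, `α` divides every `θ γ`; the quotient stays logarithmic along `L ≠ H`, since
the form of `L` is prime and does not divide `α`. -/
theorem restrictDer_eq_zero_iff (hH : H ∈ A.hyperplanes) (hα : LinearMap.ker α = H)
    (hv : α v = 1) {θ : Derivation K (CoordRing K V) (CoordRing K V)} (hθ : θ ∈ A.logDer) :
    restrictDer hα hv θ = 0 ↔ ∃ η ∈ (A.deletion H).logDer, θ = form α • η := by
  have h0 : α ≠ 0 := ne_zero_of_isCoatom_ker (by rw [hα]; exact A.isCoatom H hH)
  have hθα : form α ∣ θ (form α) := hθ α (by rwa [hα])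
  constructor
  · intro h
    obtain ⟨η, rfl⟩ := exists_eq_smul h0 (θ := θ) fun γ => by
      rw [← pullback_subtype_eq_zero_iff hα h0, ← restrictDer_form_comp hα hv hθα, h]
      rfl
    refine ⟨η, fun γ hγ => ?_, rfl⟩
    have h1 := hθ γ hγ.1
    have hγ0 := ne_zero_of_isCoatom_ker (A.isCoatom _ hγ.1)
    refine ((prime_form hγ0).dvd_or_dvd h1).resolve_left fun hd => hγ.2 ?_
    rw [ker_eq_of_form_dvd h0 hd, hα]
    rfl
  · rintro ⟨η, -, rfl⟩
    rw [restrictDer_smul, pullback_subtype_form hα, zero_smul]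

theorem smul_mem_logDer (hH : H ∈ A.hyperplanes) (hα : LinearMap.ker α = H)
    {η : Derivation K (CoordRing K V) (CoordRing K V)} (hη : η ∈ (A.deletion H).logDer) :
    form α • η ∈ A.logDer :=
  (mem_logDer_iff hH hα).2 ⟨Submodule.smul_mem _ _ hη, Dvd.intro _ rfl⟩

/-! ### Lifting derivations from the restriction -/

/-- The product of the forms of those hyperplanes other than `H` that do not meet `H` in `X`. -/
noncomputable def awayProduct (A : HypArrangement K V) (H : Submodule K V) (X : Submodule K H) :
    CoordRing K V :=
  open Classical in
  ∏ L ∈ (A.deletion H).finite.toFinset with L.comap H.subtype ≠ X, form (equation L)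

/-- If `η β = β * h`, extend `η` so that both `α` and the extension of `β` are multiplied by the
same extension of `h`. Then so is every form in their span, in particular that of each `L` with
trace `X`. The factor `awayProduct` takes care of all other hyperplanes. -/
theorem exists_lift_awayProduct (hH : H ∈ A.hyperplanes) (hα : LinearMap.ker α = H)
    (hv : α v = 1) {η : Derivation K (CoordRing K H) (CoordRing K H)}
    (hη : η ∈ (A.restriction H hH).logDer) {X : Submodule K H} (hX : IsCoatom X) :
    ∃ θ ∈ A.logDer,
      restrictDer hα hv θ = pullback H.subtype (awayProduct A H X) • η := by
  classical
  obtain ⟨β, hβ⟩ := exists_ker_eq hX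
  obtain ⟨h, hh⟩ : ∃ h, X ∈ (A.restriction H hH).hyperplanes → η (form β) = form β * h := by
    by_cases hXA : X ∈ (A.restriction H hH).hyperplanes
    · obtain ⟨h, hh⟩ := hη β (by rwa [hβ])
      exact ⟨h, fun _ => hh⟩
    -- If `X` is not a trace, no hyperplane lies over it and any `h` will do.
    · exact ⟨0, fun h => absurd h hXA⟩
  let s := pullback (hyperProj hα hv)
  let c : CoordRing K V := form α * s h
  let g : Module.Dual K V →ₗ[K] CoordRing K V :=
    s.toLinearMap ∘ₗ η.toLinearMap ∘ₗ SymmetricAlgebra.ι K (Module.Dual K H) ∘ₗ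
      H.subtype.dualMap + (LinearMap.toSpanSingleton K _ c) ∘ₗ Module.Dual.eval K V v
  have hg : ∀ γ, g γ = s (η (form (γ ∘ₗ H.subtype))) + γ v • c := fun γ => rfl
  have hα0 : α ∘ₗ H.subtype = 0 := by
    apply LinearMap.ext
    rintro ⟨x, hx⟩
    rwa [← hα] at hx
  have hgα : g α = form α * s h := by
    rw [hg, hα0, form_eq_zero_iff.2 rfl, map_zero, map_zero, hv, one_smul, zero_add]
  have hαdvd : form α ∣ derivationOf g (form α) := by
    rw [derivationOf_form, hgα]
    exact Dvd.intro _ rfl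
  refine ⟨awayProduct A H X • derivationOf g, (mem_logDer_iff hH hα).2 ⟨?_, ?_⟩, ?_⟩
  · intro γ hγ
    have hγ0 := ne_zero_of_isCoatom_ker (A.isCoatom _ hγ.1)
    rw [Derivation.smul_apply, smul_eq_mul]
    by_cases hL : (LinearMap.ker γ).comap H.subtype = X
    · apply Dvd.dvd.mul_left
      rw [derivationOf_form]
      obtain ⟨t, ht⟩ := exists_eq_smul_of_ker_le (γ := β) (γ' := γ ∘ₗ H.subtype)
        (by rw [hβ, ker_comp_subtype, hL])
      refine ⟨s h, ?_⟩
      rw [hg, ht, form_smul, Derivation.map_smul, hh ⟨_, hγ, hL⟩, map_smul, map_mul,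
        form_eq_add hα hv γ, ht, add_mul, smul_mul_assoc]
      congr 1
      rw [LinearMap.smul_comp, form_smul, smul_mul_assoc]
      congr 2
      exact pullback_form _ _
    · apply Dvd.dvd.mul_right
      have hd : form γ ∣ form (equation (LinearMap.ker γ)) := by
        obtain ⟨t, ht⟩ := exists_eq_smul_of_ker_le (γ := γ) (γ' := equation (LinearMap.ker γ))
          (ker_equation (A.isCoatom _ hγ.1)).ge
        rw [ht, form_smul, Algebra.smul_def]
        exact Dvd.intro_left _ rfl
      refine hd.trans (Finset.dvd_prod_of_mem (fun L => form (equation L)) ?_)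
      rw [Finset.mem_filter, Set.Finite.mem_toFinset]
      exact ⟨hγ, hL⟩
  · rw [Derivation.smul_apply]
    exact hαdvd.mul_left _
  · rw [restrictDer_smul]
    congr 1
    apply derivation_ext
    intro γ
    rw [restrictDer_form, derivationOf_form, hg, map_add, map_smul, map_mul,
      pullback_subtype_form hα, zero_mul, smul_zero, add_zero, pullback_pullback,
      LinearMap.comp_assoc, hyperProj_comp_subtype, LinearMap.comp_id]

theorem comp_subtype_ne_zero (hH : IsCoatom H) {L : Submodule K V} (hL : IsCoatom L)
    (hne : L ≠ H) : equation L ∘ₗ H.subtype ≠ 0 := by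
  apply ne_zero_of_isCoatom_ker
  rw [ker_comp_subtype, ker_equation hL]
  exact isCoatom_comap_subtype hH hL hne

/-- A prime dividing all these products divides the form of some trace `L ∩ H`. Taking `X = L ∩ H`,
it also divides the form of a different trace, but forms of distinct hyperplanes of `H` are not
associated. -/
theorem exists_not_dvd_awayProduct (hH : H ∈ A.hyperplanes) [Nontrivial H]
    [FiniteDimensional K V] {p : CoordRing K H} (hp : Prime p) :
    ∃ X : {X : Submodule K H // IsCoatom X},
      ¬ p ∣ pullback H.subtype (awayProduct A H X) := by
  classical
  by_contra! hcon
  have key : ∀ X : Submodule K H, IsCoatom X → ∃ L, IsCoatom L ∧ L ≠ H ∧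
      L.comap H.subtype ≠ X ∧ p ∣ form (equation L ∘ₗ H.subtype) := by
    intro X hX
    have h := hcon ⟨X, hX⟩
    rw [awayProduct, map_prod] at h
    obtain ⟨L, hL, hd⟩ := (Prime.dvd_finsetProd_iff hp _).1 h
    rw [Finset.mem_filter, Set.Finite.mem_toFinset] at hL
    rw [pullback_form] at hd
    exact ⟨L, A.isCoatom L hL.1.1, hL.1.2, hL.2, hd⟩
  obtain ⟨X, hX⟩ := IsCoatomic.exists_coatom (Submodule K H)
  obtain ⟨L, hL, hLH, -, hd⟩ := key X hX
  have hHc := A.isCoatom H hH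
  obtain ⟨L', hL', hLH', hne, hd'⟩ := key _ (isCoatom_comap_subtype hHc hL hLH)
  have h0 := comp_subtype_ne_zero hHc hL hLH
  have h0' := comp_subtype_ne_zero hHc hL' hLH'
  have hass := (hp.associated_of_dvd (prime_form h0) hd).symm.trans
    (hp.associated_of_dvd (prime_form h0') hd')
  have hk := ker_eq_of_form_dvd h0' hass.dvd
  rw [ker_comp_subtype, ker_comp_subtype, ker_equation hL, ker_equation hL'] at hk
  exact hne hk.symm

theorem awayProduct_ne_zero (hH : H ∈ A.hyperplanes) (X : Submodule K H) :
    pullback H.subtype (awayProduct A H X) ≠ 0 := by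
  classical
  rw [awayProduct, map_prod, Finset.prod_ne_zero_iff]
  intro L hL
  rw [Finset.mem_filter, Set.Finite.mem_toFinset] at hL
  rw [pullback_form]
  exact (prime_form (comp_subtype_ne_zero (A.isCoatom H hH) (A.isCoatom L hL.1.1)
    hL.1.2)).ne_zero

/-- If the module of logarithmic derivations of the deletion is free, then the restriction map
to the hyperplane is surjective. -/
theorem restrictDer_surjective (hH : H ∈ A.hyperplanes) [Nontrivial H] [FiniteDimensional K V]
    (hα : LinearMap.ker α = H) (hv : α v = 1) {ι : Type*} [Fintype ι]
    {φ : ι → Derivation K (CoordRing K V) (CoordRing K V)}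
    (hφ : ∀ θ, θ ∈ (A.deletion H).logDer ↔ ∃ g : ι → CoordRing K V, θ = ∑ k, g k • φ k)
    (hli : ∀ g : ι → CoordRing K V, ∑ k, g k • φ k = 0 → ∀ k, g k = 0)
    {η : Derivation K (CoordRing K H) (CoordRing K H)}
    (hη : η ∈ (A.restriction H hH).logDer) : ∃ θ ∈ A.logDer, restrictDer hα hv θ = η := by
  have h0 : α ≠ 0 := ne_zero_of_isCoatom_ker (by rw [hα]; exact A.isCoatom H hH)
  have hlift : ∀ X : {X : Submodule K H // IsCoatom X}, ∃ g : ι → CoordRing K V,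
      (∑ k, g k • φ k) ∈ A.logDer ∧ restrictDer hα hv (∑ k, g k • φ k) =
        pullback H.subtype (awayProduct A H X) • η := by
    intro X
    obtain ⟨θ, hθ, hθη⟩ := exists_lift_awayProduct hH hα hv hη X.2
    obtain ⟨g, rfl⟩ := (hφ θ).1 ((mem_logDer_iff hH hα).1 hθ).1
    exact ⟨g, hθ, hθη⟩
  choose g hg hgη using hlift
  -- The lifts for `X` and `Y`, cross-multiplied, have the same restriction and thus differ by an
  -- element of `α D(A')`. By freeness their coordinates agree modulo `α`.
  have hcross : ∀ (X Y : {X : Submodule K H // IsCoatom X}) (k : ι),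
      pullback H.subtype (awayProduct A H Y) * pullback H.subtype (g X k) =
      pullback H.subtype (awayProduct A H X) * pullback H.subtype (g Y k) := by
    intro X Y k
    have hmem : awayProduct A H Y • (∑ k, g X k • φ k) -
        awayProduct A H X • (∑ k, g Y k • φ k) ∈ A.logDer :=
      sub_mem (Submodule.smul_mem _ _ (hg X)) (Submodule.smul_mem _ _ (hg Y))
    obtain ⟨ζ, hζ, heq⟩ := (restrictDer_eq_zero_iff hH hα hv hmem).1 (by
      rw [map_sub, restrictDer_smul, restrictDer_smul, hgη, hgη, smul_comm, sub_self])
    obtain ⟨f, rfl⟩ := (hφ ζ).1 hζ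
    have hz := hli (fun k => awayProduct A H Y * g X k - awayProduct A H X * g Y k -
      form α * f k) (by
        rw [sum_sub_smul, sum_sub_smul, sum_mul_smul, sum_mul_smul, sum_mul_smul, heq, sub_self]) k
    have h1 : awayProduct A H Y * g X k - awayProduct A H X * g Y k = form α * f k :=
      sub_eq_zero.1 hz
    have h2 := congrArg (pullback H.subtype) h1
    rw [map_sub, map_mul, map_mul, map_mul, pullback_subtype_form hα, zero_mul, sub_eq_zero] at h2
    exact h2
  obtain ⟨X, hX⟩ := IsCoatomic.exists_coatom (Submodule K H)
  -- Because the products for the various `Y` have no common prime, the cross relations let the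
  -- product for `X` divide every coordinate modulo `α`. Dividing by it gives the desired lift.
  have hdvd : ∀ k, ∃ f, form α ∣ g ⟨X, hX⟩ k - awayProduct A H X * f := by
    intro k
    obtain ⟨t, ht⟩ : pullback H.subtype (awayProduct A H X) ∣ pullback H.subtype (g ⟨X, hX⟩ k) :=
      dvd_of_forall_dvd_mul (fun p hp => exists_not_dvd_awayProduct hH hp)
        (awayProduct_ne_zero hH X) fun Y => ⟨_, hcross ⟨X, hX⟩ Y k⟩
    obtain ⟨f, rfl⟩ := pullback_subtype_surjective hα h0 t
    refine ⟨f, ?_⟩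
    rw [← pullback_subtype_eq_zero_iff hα h0, map_sub, map_mul, ht, sub_self]
  choose f u hfu using hdvd
  have hsum : ∑ k, g ⟨X, hX⟩ k • φ k =
      awayProduct A H X • (∑ k, f k • φ k) + form α • ∑ k, u k • φ k := by
    rw [Finset.smul_sum, Finset.smul_sum, ← Finset.sum_add_distrib]
    refine Finset.sum_congr rfl fun k _ => ?_
    rw [smul_smul, smul_smul, ← add_smul, ← hfu]
    congr 1
    ring
  have hu : (form α • ∑ k, u k • φ k) ∈ A.logDer := smul_mem_logDer hH hα ((hφ _).2 ⟨u, rfl⟩)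
  have hPf : awayProduct A H X • (∑ k, f k • φ k) ∈ A.logDer := by
    have := sub_mem (hg ⟨X, hX⟩) hu
    rwa [hsum, add_sub_cancel_right] at this
  have hP0 := awayProduct_ne_zero hH X
  refine ⟨∑ k, f k • φ k, (mem_logDer_iff hH hα).2 ⟨(hφ _).2 ⟨f, rfl⟩, ?_⟩, ?_⟩
  -- The factor `awayProduct A H X` is not divisible by the prime `α`, so it can be dropped from the
  -- logarithmic condition along `H`.
  · have h1 := ((mem_logDer_iff hH hα).1 hPf).2
    refine ((prime_form h0).dvd_or_dvd h1).resolve_left fun hd => hP0 ?_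
    exact (pullback_subtype_eq_zero_iff hα h0).2 hd
  · have h1 := hgη ⟨X, hX⟩
    rw [hsum, map_add, restrictDer_smul, restrictDer_smul, pullback_subtype_form hα, zero_smul,
      add_zero] at h1
    apply derivation_ext
    intro γ
    have h2 := DFunLike.congr_fun h1 (form γ)
    exact mul_left_cancel₀ hP0 h2

end HypArrangement

/-! ### The common divisor of the boundary values and the generators of `D(A)` -/

namespace HypArrangement

variable {K V : Type*} [Field K] [AddCommGroup V] [Module K V]
  {A : HypArrangement K V} {H : Submodule K V} {α : Module.Dual K V} {v : V}

/-- The values `θ(α)` for `θ` logarithmic along the hyperplanes other than `H` have, modulo `α`, a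
common divisor of degree `|A'| - |A^H|`. -/
theorem exists_common_divisor [FiniteDimensional K V] (hH : H ∈ A.hyperplanes) (hα : LinearMap.ker α = H)
    (hv : α v = 1) : ∃ (B : CoordRing K H) (b : ℕ),
      b + (A.restriction H hH).card = (A.deletion H).card ∧ B ≠ 0 ∧
      B ∈ homogeneousPart K H b ∧
      ∀ θ ∈ (A.deletion H).logDer, B ∣ pullback H.subtype (θ (form α)) := by
  classical
  have hHc := A.isCoatom H hH
  have h0 : α ≠ 0 := ne_zero_of_isCoatom_ker (by rwa [hα])
  let T : Finset (Submodule K V) := (A.deletion H).finite.toFinset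
  have hT : ∀ {L}, L ∈ T ↔ L ∈ (A.deletion H).hyperplanes := Set.Finite.mem_toFinset _
  let c : Submodule K V → Submodule K H := fun L => L.comap H.subtype
  let m : Submodule K H → ℕ := fun X => (T.filter fun L => c L = X).card
  have hU : ∀ X ∈ T.image c, IsCoatom X := by
    intro X hX
    obtain ⟨L, hL, rfl⟩ := Finset.mem_image.1 hX
    exact isCoatom_comap_subtype hHc (A.isCoatom L (hT.1 hL).1) (hT.1 hL).2
  have hm : ∀ X ∈ T.image c, 1 ≤ m X := by
    intro X hX
    obtain ⟨L, hL, rfl⟩ := Finset.mem_image.1 hX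
    exact Finset.card_pos.2 ⟨L, Finset.mem_filter.2 ⟨hL, rfl⟩⟩
  -- A trace `X` cut out by `m X` hyperplanes contributes its equation to the power `m X - 1`; the
  -- exponents sum to `|A'| - |A^H|`.
  refine ⟨∏ X ∈ T.image c, form (equation X) ^ (m X - 1), ∑ X ∈ T.image c, (m X - 1), ?_, ?_, ?_,
    ?_⟩
  · have h1 : (A.restriction H hH).card = ∑ X ∈ T.image c, 1 := by
      have h3 : (A.restriction H hH).hyperplanes = ↑(T.image c) := by
        rw [Finset.coe_image, Set.Finite.coe_toFinset]
        rfl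
      rw [Finset.sum_const, smul_eq_mul, mul_one, card, h3, Set.ncard_coe_finset]
    have h2 : (A.deletion H).card = T.card := Set.ncard_eq_toFinset_card _ (A.deletion H).finite
    rw [h1, h2, ← Finset.sum_add_distrib, Finset.card_eq_sum_card_image c T]
    exact Finset.sum_congr rfl fun X hX => Nat.sub_add_cancel (hm X hX)
  · rw [Finset.prod_ne_zero_iff]
    exact fun X hX => pow_ne_zero _ (prime_form (equation_ne_zero (hU X hX))).ne_zero
  · apply SetLike.prod_mem_graded
    intro X _
    have := SetLike.pow_mem_graded (m X - 1) (form_mem (equation X))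
    rwa [smul_eq_mul, mul_one] at this
  · intro θ hθ
    apply Finset.prod_dvd_of_isRelPrime
    · intro X hX Y hY hne
      refine (isRelPrime_form (equation_ne_zero (hU X hX)) (equation_ne_zero (hU Y hY)) ?_).pow
      rwa [ker_equation (hU X hX), ker_equation (hU Y hY)]
    intro X hX
    have hXc := hU X hX
    set β := equation X with hβ
    have hβk : LinearMap.ker β = X := ker_equation hXc
    have hβ0 : form β ≠ 0 := (prime_form (equation_ne_zero hXc)).ne_zero
    let β' := β ∘ₗ hyperProj hα hv
    -- This expression is alternating in `β'` and `α`. Replacing `β'` by the equation of any `L`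
    -- over `X`, a combination of `β'` and `α`, only rescales it, so each such equation divides it.
    let W := form β' * θ (form α) - form α * θ (form β')
    have hsub : ∀ L ∈ T.filter fun L => c L = X, ∃ t : K, t ≠ 0 ∧
        equation L ∘ₗ H.subtype = t • β := by
      intro L hL
      obtain ⟨hLT, hLX⟩ := Finset.mem_filter.1 hL
      have hLc := A.isCoatom L (hT.1 hLT).1
      obtain ⟨t, ht⟩ := exists_eq_smul_of_ker_le (γ := β) (γ' := equation L ∘ₗ H.subtype)
        (by rw [hβk, ker_comp_subtype, ker_equation hLc]; exact hLX.ge)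
      refine ⟨t, ?_, ht⟩
      rintro rfl
      exact comp_subtype_ne_zero hHc hLc (hT.1 hLT).2 (by rw [ht, zero_smul])
    have hW : ∏ L ∈ T.filter (fun L => c L = X), form (equation L) ∣ W := by
      apply Finset.prod_dvd_of_isRelPrime
      · intro L hL L' hL' hne
        have hLc := A.isCoatom L (hT.1 (Finset.mem_filter.1 hL).1).1
        have hLc' := A.isCoatom L' (hT.1 (Finset.mem_filter.1 hL').1).1
        refine isRelPrime_form (equation_ne_zero hLc) (equation_ne_zero hLc') ?_
        rwa [ker_equation hLc, ker_equation hLc']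
      · intro L hL
        obtain ⟨t, ht0, ht⟩ := hsub L hL
        have hLT := hT.1 (Finset.mem_filter.1 hL).1
        have hθL := hθ (equation L) (by rwa [ker_equation (A.isCoatom L hLT.1)])
        rw [← dvd_smul_iff ht0]
        have hdec := form_eq_add hα hv (equation L)
        rw [ht, LinearMap.smul_comp, form_smul] at hdec
        have h1 : t • form β' = form (equation L) - equation L v • form α :=
          eq_sub_of_add_eq hdec.symm
        have h2 : t • θ (form β') = θ (form (equation L)) - equation L v • θ (form α) := by
          rw [← Derivation.map_smul, h1, map_sub, Derivation.map_smul]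
        have h3 : t • W = form (equation L) * θ (form α) - form α * θ (form (equation L)) := by
          change t • (form β' * θ (form α) - form α * θ (form β')) = _
          rw [smul_sub, ← smul_mul_assoc, h1, ← mul_smul_comm, h2, sub_mul, mul_sub,
            smul_mul_assoc, mul_smul_comm]
          abel
        rw [h3]
        exact dvd_sub (Dvd.intro _ rfl) (hθL.mul_left _)
    have hWr : pullback H.subtype W = form β * pullback H.subtype (θ (form α)) := by
      change pullback H.subtype (form β' * θ (form α) - form α * θ (form β')) = _
      rw [map_sub, map_mul, map_mul, pullback_subtype_form hα, zero_mul, sub_zero, pullback_form]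
      congr 2
      change (β ∘ₗ hyperProj hα hv) ∘ₗ H.subtype = β
      rw [LinearMap.comp_assoc, hyperProj_comp_subtype, LinearMap.comp_id]
    -- On `H` the `m X` equations over `X` all become multiples of `β`, while `W` becomes `β` times
    -- the value of `θ` at `α`; cancelling one `β` leaves the power `m X - 1`.
    have hpow : form β ^ m X ∣ pullback H.subtype W := by
      refine Dvd.dvd.trans ?_ (map_dvd (pullback H.subtype) hW)
      rw [map_prod, ← Finset.prod_const]
      apply Finset.prod_dvd_prod_of_dvd
      intro L hL
      obtain ⟨t, ht0, ht⟩ := hsub L hL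
      rw [pullback_form, ht, form_smul, dvd_smul_iff ht0]
    rw [hWr, ← Nat.sub_add_cancel (hm X hX), pow_succ, mul_comm] at hpow
    exact (mul_dvd_mul_iff_left hβ0).1 hpow

set_option maxHeartbeats 1000000 in
/-- Generators and relations of the module of logarithmic derivations when the values of a
homogeneous basis of the deletion at `α` are modulo `α` generated by two of them, with only the
trivial syzygies. -/
theorem exists_generators (hH : H ∈ A.hyperplanes) (hα : LinearMap.ker α = H)
    {ι : Type*} [Fintype ι] [DecidableEq ι]
    {θ : ι → Derivation K (CoordRing K V) (CoordRing K V)} {d : ι → ℕ}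
    (hhom : ∀ k, IsHomogeneousOfDegree (θ k) (d k))
    (hθ : ∀ ζ, ζ ∈ (A.deletion H).logDer ↔ ∃ g : ι → CoordRing K V, ζ = ∑ k, g k • θ k)
    (hli : ∀ g : ι → CoordRing K V, ∑ k, g k • θ k = 0 → ∀ k, g k = 0)
    {F f : ι → CoordRing K H} (hF : ∀ k, F k = pullback H.subtype (θ k (form α)))
    {B : CoordRing K H} (hf : ∀ k, F k = B * f k) {b δ : ℕ}
    (hfmem : ∀ k, f k ∈ shiftedPart (homogeneousPart K H) b (d k)) {a c : ι} (hac : a ≠ c)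
    (hδ : δ + b = d a + d c) (hba : b < d a) (hbc : b < d c) (hFc : F c ≠ 0)
    (hgen : ∀ k, ∃ x ∈ shiftedPart (homogeneousPart K H) (d a) (d k),
      ∃ y ∈ shiftedPart (homogeneousPart K H) (d c) (d k), F k = x * F a + y * F c)
    (hsyz : ∀ x y, x * F a + y * F c = 0 → ∃ t, x = t * f c ∧ y = -(t * f a)) :
    ∃ (Φ : ι → Derivation K (CoordRing K V) (CoordRing K V))
      (φ : Derivation K (CoordRing K V) (CoordRing K V)) (w : ι → CoordRing K V),
      (∀ k, Φ k ∈ A.logDer) ∧ φ ∈ A.logDer ∧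
      (∀ k, IsHomogeneousOfDegree (Φ k) (if k = a ∨ k = c then d k + 1 else d k)) ∧
      IsHomogeneousOfDegree φ δ ∧
      Φ a = form α • θ a ∧ Φ c = form α • θ c ∧
      (∀ ζ ∈ A.logDer, ∃ (g : ι → CoordRing K V) (t : CoordRing K V),
        ζ = ∑ k, g k • Φ k + t • φ) ∧
      (∀ (g : ι → CoordRing K V) (t : CoordRing K V), ∀ η ∈ (A.deletion H).logDer,
        ∑ k, g k • Φ k + t • φ = form α • η →
          (∀ k, k ≠ a → k ≠ c → form α ∣ g k) ∧ form α ∣ t) ∧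
      (∀ (g : ι → CoordRing K V) (t : CoordRing K V), ∑ k, g k • Φ k + t • φ = 0 ↔
        ∃ s, t = s * form α ∧ ∀ k, g k = s * w k) ∧
      ∀ k, w k = 0 ∨ ∃ j, 0 < j ∧ (if k = a ∨ k = c then d k + 1 else d k) + j = δ + 1 ∧
        w k ∈ homogeneousPart K V j := by
  have h0 : α ≠ 0 := ne_zero_of_isCoatom_ker (by rw [hα]; exact A.isCoatom H hH)
  have hθmem : ∀ k, θ k ∈ (A.deletion H).logDer := fun k => (hθ _).2
    ⟨Pi.single k 1, by rw [Finset.sum_eq_single k] <;> simp +contextual⟩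
  have hfc : f c ≠ 0 := fun h => hFc (by rw [hf, h, mul_zero])
  have hmem : ∀ {ζ}, ζ ∈ (A.deletion H).logDer → pullback H.subtype (ζ (form α)) = 0 →
      ζ ∈ A.logDer := fun h1 h2 =>
    (mem_logDer_iff hH hα).2 ⟨h1, (pullback_subtype_eq_zero_iff hα h0).1 h2⟩
  have hmem' : ∀ {ζ}, ζ ∈ A.logDer → pullback H.subtype (ζ (form α)) = 0 := fun h =>
    (pullback_subtype_eq_zero_iff hα h0).2 ((mem_logDer_iff hH hα).1 h).2
  choose x hx y hy hxy using hgen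
  choose X' hX' hXx using fun k => exists_shifted_lift hα h0 (hx k)
  choose Y' hY' hYy using fun k => exists_shifted_lift hα h0 (hy k)
  obtain ⟨Pa, hPa, hPaf⟩ := exists_shifted_lift hα h0 (hfmem a)
  obtain ⟨Pc, hPc, hPcf⟩ := exists_shifted_lift hα h0 (hfmem c)
  have hPcα : ¬ form α ∣ Pc := by
    rw [← pullback_subtype_eq_zero_iff hα h0, hPcf]
    exact hfc
  let X : ι → CoordRing K V := fun k => if k = a ∨ k = c then 0 else X' k
  let Y : ι → CoordRing K V := fun k => if k = a ∨ k = c then 0 else Y' k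
  -- With `E`, `X`, `Y` one formula covers both kinds of generators: `α θ_k` for `k = a, c`, and
  -- otherwise `θ_k` corrected so that its value at `α` vanishes on `H`.
  let E : ι → CoordRing K V := fun k => if k = a ∨ k = c then form α else 1
  let Φ : ι → Derivation K (CoordRing K V) (CoordRing K V) := fun k =>
    E k • θ k - X k • θ a - Y k • θ c
  let φ := Pc • θ a - Pa • θ c
  -- Together with the coefficient `α` of `φ`, this is the relation `α φ = Pc (α θ_a) - Pa (α θ_c)`.
  let w : ι → CoordRing K V := fun k => if k = a then -Pc else if k = c then Pa else 0
  have hXs : ∀ {k}, k = a ∨ k = c → X k = 0 := fun h => if_pos h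
  have hYs : ∀ {k}, k = a ∨ k = c → Y k = 0 := fun h => if_pos h
  have hEs : ∀ {k}, k = a ∨ k = c → E k = form α := fun h => if_pos h
  have hXn : ∀ {k}, ¬ (k = a ∨ k = c) → X k = X' k := fun h => if_neg h
  have hYn : ∀ {k}, ¬ (k = a ∨ k = c) → Y k = Y' k := fun h => if_neg h
  have hEn : ∀ {k}, ¬ (k = a ∨ k = c) → E k = 1 := fun h => if_neg h
  have hΦs : ∀ {k}, k = a ∨ k = c → Φ k = form α • θ k := by
    intro k h
    change E k • θ k - X k • θ a - Y k • θ c = _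
    rw [hXs h, hYs h, hEs h, zero_smul, zero_smul, sub_zero, sub_zero]
  have hΦn : ∀ {k}, ¬ (k = a ∨ k = c) → Φ k = θ k - X' k • θ a - Y' k • θ c := by
    intro k h
    change E k • θ k - X k • θ a - Y k • θ c = _
    rw [hXn h, hYn h, hEn h, one_smul]
  have hcoord : ∀ (g : ι → CoordRing K V) (t : CoordRing K V), ∑ k, g k • Φ k + t • φ =
      ∑ k, (g k * E k + (if k = a then t * Pc - ∑ j, g j * X j else 0) +
        if k = c then -(t * Pa) - ∑ j, g j * Y j else 0) • θ k := by
    intro g t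
    have h1 : ∀ k, g k • Φ k = (g k * E k) • θ k - (g k * X k) • θ a - (g k * Y k) • θ c := by
      intro k
      change g k • (E k • θ k - X k • θ a - Y k • θ c) = _
      rw [smul_sub, smul_sub, smul_smul, smul_smul, smul_smul]
    have h2 : t • φ = (t * Pc) • θ a - (t * Pa) • θ c := by
      change t • (Pc • θ a - Pa • θ c) = _
      rw [smul_sub, smul_smul, smul_smul]
    rw [sum_add_smul, sum_add_smul, sum_ite_smul, sum_ite_smul, h2, derivation_sub_smul,
      derivation_sub_smul, derivation_neg_smul,
      Finset.sum_smul, Finset.sum_smul, Finset.sum_congr rfl fun k _ => h1 k,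
      Finset.sum_sub_distrib, Finset.sum_sub_distrib]
    abel
  have hΦmem : ∀ k, Φ k ∈ A.logDer := by
    intro k
    by_cases h : k = a ∨ k = c
    · rw [hΦs h]
      exact smul_mem_logDer hH hα (hθmem k)
    · rw [hΦn h]
      refine hmem (sub_mem (sub_mem (hθmem k) (Submodule.smul_mem _ _ (hθmem a)))
        (Submodule.smul_mem _ _ (hθmem c))) ?_
      rw [Derivation.sub_apply, Derivation.sub_apply, Derivation.smul_apply,
        Derivation.smul_apply, map_sub, map_sub, smul_eq_mul, smul_eq_mul, map_mul, map_mul,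
        ← hF, ← hF, ← hF, hXx, hYy, hxy k]
      ring
  have hφmem : φ ∈ A.logDer := by
    refine hmem (sub_mem (Submodule.smul_mem _ _ (hθmem a))
        (Submodule.smul_mem _ _ (hθmem c))) ?_
    rw [Derivation.sub_apply, Derivation.smul_apply, Derivation.smul_apply, map_sub,
      smul_eq_mul, smul_eq_mul, map_mul, map_mul, ← hF, ← hF, hPcf, hPaf, hf a, hf c]
    ring
  -- Compare coordinates in the basis `θ`: away from `a` and `c` the coordinate is `g k` itself.
  -- Modulo `α` the one at `a` is then `t * Pc`, and `α` does not divide `Pc`.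
  have hred : ∀ (g : ι → CoordRing K V) (t : CoordRing K V), ∀ η ∈ (A.deletion H).logDer,
        ∑ k, g k • Φ k + t • φ = form α • η →
          (∀ k, k ≠ a → k ≠ c → form α ∣ g k) ∧ form α ∣ t := by
    intro g t η hη heq
    obtain ⟨u, rfl⟩ := (hθ η).1 hη
    rw [hcoord] at heq
    have hz := hli (fun k => (g k * E k + (if k = a then t * Pc - ∑ j, g j * X j else 0) +
        if k = c then -(t * Pa) - ∑ j, g j * Y j else 0) - form α * u k) (by
      rw [sum_sub_smul, sum_mul_smul, heq, sub_self])
    have hg : ∀ k, k ≠ a → k ≠ c → form α ∣ g k := by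
      intro k hka hkc
      have := hz k
      rw [if_neg hka, if_neg hkc, hEn (by tauto), mul_one, add_zero, add_zero, sub_eq_zero] at this
      exact ⟨_, this⟩
    refine ⟨hg, ?_⟩
    have h1 := hz a
    rw [if_pos rfl, if_neg hac, hEs (Or.inl rfl), add_zero] at h1
    have h2 : form α ∣ ∑ j, g j * X j := by
      apply Finset.dvd_sum
      intro j _
      by_cases h : j = a ∨ j = c
      · rw [hXs h, mul_zero]
        exact dvd_zero _
      · rw [not_or] at h
        exact (hg j h.1 h.2).mul_right _
    have h3 : form α ∣ t * Pc := by
      have : t * Pc = form α * (u a - g a) + ∑ j, g j * X j := by linear_combination h1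
      rw [this]
      exact dvd_add (Dvd.intro _ rfl) h2
    exact ((prime_form h0).dvd_or_dvd h3).resolve_right hPcα
  have hwX : ∀ (Z : ι → CoordRing K V), (∀ {k}, k = a ∨ k = c → Z k = 0) →
      ∀ s, ∑ k, s * w k * Z k = 0 := by
    intro Z hZ s
    apply Finset.sum_eq_zero
    intro k _
    by_cases h : k = a ∨ k = c
    · rw [hZ h, mul_zero]
    · rw [not_or] at h
      change s * (if k = a then -Pc else if k = c then Pa else 0) * Z k = 0
      rw [if_neg h.1, if_neg h.2, mul_zero, zero_mul]
  have hwa : w a = -Pc := if_pos rfl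
  have hwc : w c = Pa := by
    change (if c = a then -Pc else if c = c then Pa else 0) = Pa
    rw [if_neg hac.symm, if_pos rfl]
  refine ⟨Φ, φ, w, hΦmem, hφmem, ?_, ?_, hΦs (Or.inl rfl), hΦs (Or.inr rfl), ?_, hred, ?_, ?_⟩
  · intro k
    by_cases h : k = a ∨ k = c
    · rw [hΦs h, if_pos h]
      exact isHomogeneousOfDegree_smul (hhom k) (mem_shiftedPart _ (form_mem α) (Nat.add_comm _ _))
    · rw [hΦn h, if_neg h]
      exact (homogeneousDer K V (d k)).sub_mem ((homogeneousDer K V (d k)).sub_mem (hhom k)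
        (isHomogeneousOfDegree_smul (hhom a) (hX' k)))
        (isHomogeneousOfDegree_smul (hhom c) (hY' k))
  · refine (homogeneousDer K V δ).sub_mem (isHomogeneousOfDegree_smul (hhom a) ?_)
      (isHomogeneousOfDegree_smul (hhom c) ?_)
    · rcases mem_shiftedPart_cases _ hPc with h | ⟨j, hj, hjm⟩
      · rw [h]; exact zero_mem _
      · exact mem_shiftedPart _ hjm (by omega)
    · rcases mem_shiftedPart_cases _ hPa with h | ⟨j, hj, hjm⟩
      · rw [h]; exact zero_mem _
      · exact mem_shiftedPart _ hjm (by omega)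
  · intro ζ hζ
    obtain ⟨g, rfl⟩ := (hθ ζ).1 ((mem_logDer_iff hH hα).1 hζ).1
    let x₀ := g a + ∑ j, g j * X j
    let y₀ := g c + ∑ j, g j * Y j
    -- Once every other `F k` is expressed through `F a` and `F c`, membership in `D(A)` becomes a
    -- syzygy of these two. It is a trivial one, accounted for by `t • φ`; what remains at `a` and
    -- `c` is divisible by `α`.
    have hsum : pullback H.subtype x₀ * F a + pullback H.subtype y₀ * F c = 0 := by
      have h1 : ∀ k, pullback H.subtype (X k) * F a + pullback H.subtype (Y k) * F c =
          if k = a ∨ k = c then 0 else F k := by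
        intro k
        split_ifs with h
        · rw [hXs h, hYs h, map_zero, zero_mul, zero_mul, add_zero]
        · rw [hXn h, hYn h, hXx, hYy, ← hxy]
      have h2 : pullback H.subtype x₀ * F a + pullback H.subtype y₀ * F c =
          pullback H.subtype (g a) * F a + pullback H.subtype (g c) * F c +
          ∑ k, pullback H.subtype (g k) * (pullback H.subtype (X k) * F a +
            pullback H.subtype (Y k) * F c) := by
        change pullback H.subtype (g a + ∑ j, g j * X j) * F a +
          pullback H.subtype (g c + ∑ j, g j * Y j) * F c = _
        simp only [map_add, map_sum, map_mul, mul_add, add_mul, Finset.sum_add_distrib,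
          Finset.sum_mul, mul_assoc]
        ring
      have h3 := hmem' hζ
      rw [sum_smul_apply, map_sum] at h3
      simp only [map_mul, ← hF] at h3
      rw [h2]
      simp only [h1]
      have h4 : ∀ k, pullback H.subtype (g k) * F k =
          (pullback H.subtype (g k) * if k = a ∨ k = c then 0 else F k) +
          ((if k = a then pullback H.subtype (g a) * F a else 0) +
          if k = c then pullback H.subtype (g c) * F c else 0) := by
        intro k
        by_cases hka : k = a
        · subst hka
          rw [if_pos (Or.inl rfl), if_pos rfl, if_neg hac, mul_zero, zero_add, add_zero]
        · by_cases hkc : k = c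
          · subst hkc
            rw [if_pos (Or.inr rfl), if_pos rfl, if_neg hka, mul_zero, zero_add, zero_add]
          · rw [if_neg hka, if_neg hkc, if_neg (by tauto), add_zero, add_zero]
      rw [Finset.sum_congr rfl fun k _ => h4 k, Finset.sum_add_distrib, Finset.sum_add_distrib,
        Finset.sum_ite_eq', Finset.sum_ite_eq', if_pos (Finset.mem_univ _),
        if_pos (Finset.mem_univ _)] at h3
      rw [add_comm]
      exact h3
    obtain ⟨t', ht1, ht2⟩ := hsyz _ _ hsum
    obtain ⟨t, rfl⟩ := pullback_subtype_surjective hα h0 t'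
    obtain ⟨u, hu⟩ := (pullback_subtype_eq_zero_iff hα h0 (x := x₀ - t * Pc)).1 (by
      rw [map_sub, map_mul, hPcf, ht1, sub_self])
    obtain ⟨z, hz⟩ := (pullback_subtype_eq_zero_iff hα h0 (x := y₀ + t * Pa)).1 (by
      rw [map_add, map_mul, hPaf, ht2, neg_add_cancel])
    let g' : ι → CoordRing K V := fun k => if k = a then u else if k = c then z else g k
    have hg' : ∀ (Z : ι → CoordRing K V), (∀ {k}, k = a ∨ k = c → Z k = 0) →
        ∑ k, g' k * Z k = ∑ k, g k * Z k := by
      intro Z hZ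
      refine Finset.sum_congr rfl fun k _ => ?_
      by_cases h : k = a ∨ k = c
      · rw [hZ h, mul_zero, mul_zero]
      · rw [not_or] at h
        change (if k = a then u else if k = c then z else g k) * Z k = _
        rw [if_neg h.1, if_neg h.2]
    have hg'a : g' a = u := if_pos rfl
    have hg'c : g' c = z := by
      change (if c = a then u else if c = c then z else g c) = z
      rw [if_neg hac.symm, if_pos rfl]
    refine ⟨g', t, ?_⟩
    rw [hcoord]
    refine Finset.sum_congr rfl fun k _ => ?_
    congr 1
    rw [hg' X hXs, hg' Y hYs]
    by_cases hka : k = a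
    · subst hka
      rw [if_pos rfl, if_neg hac, hg'a, hEs (Or.inl rfl)]
      linear_combination hu
    · by_cases hkc : k = c
      · subst hkc
        rw [if_neg hka, if_pos rfl, hg'c, hEs (Or.inr rfl)]
        linear_combination hz
      · rw [if_neg hka, if_neg hkc, hEn (by tauto)]
        change g k = (if k = a then u else if k = c then z else g k) * 1 + 0 + 0
        rw [if_neg hka, if_neg hkc]
        ring
  · intro g t
    constructor
    · intro h
      obtain ⟨hg, s, rfl⟩ := hred g t 0 (zero_mem _) (by rw [h, smul_zero])
      rw [hcoord] at h
      have hz := hli _ h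
      have hgk : ∀ k, k ≠ a → k ≠ c → g k = 0 := by
        intro k hka hkc
        have := hz k
        rwa [if_neg hka, if_neg hkc, hEn (by tauto), mul_one, add_zero, add_zero] at this
      have hgX : ∀ (Z : ι → CoordRing K V), (∀ {k}, k = a ∨ k = c → Z k = 0) →
          ∑ k, g k * Z k = 0 := by
        intro Z hZ
        refine Finset.sum_eq_zero fun k _ => ?_
        by_cases h : k = a ∨ k = c
        · rw [hZ h, mul_zero]
        · rw [not_or] at h
          rw [hgk k h.1 h.2, zero_mul]
      have hα0 := (prime_form h0).ne_zero
      refine ⟨s, mul_comm _ _, fun k => ?_⟩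
      have hk := hz k
      by_cases hka : k = a
      · subst hka
        rw [if_pos rfl, if_neg hac, hEs (Or.inl rfl), hgX X hXs] at hk
        rw [hwa]
        exact mul_left_cancel₀ hα0 (by linear_combination hk)
      · by_cases hkc : k = c
        · subst hkc
          rw [if_neg hka, if_pos rfl, hEs (Or.inr rfl), hgX Y hYs] at hk
          rw [hwc]
          exact mul_left_cancel₀ hα0 (by linear_combination hk)
        · change g k = s * (if k = a then -Pc else if k = c then Pa else 0)
          rw [if_neg hka, if_neg hkc, hgk k hka hkc, mul_zero]
    · rintro ⟨s, rfl, hg⟩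
      obtain rfl : g = fun k => s * w k := funext hg
      rw [hcoord, hwX X hXs, hwX Y hYs]
      refine Finset.sum_eq_zero fun k _ => ?_
      by_cases hka : k = a
      · subst hka
        rw [if_pos rfl, if_neg hac, hEs (Or.inl rfl), hwa]
        apply smul_eq_zero_of_left
        ring
      · by_cases hkc : k = c
        · subst hkc
          rw [if_neg hka, if_pos rfl, hEs (Or.inr rfl), hwc]
          apply smul_eq_zero_of_left
          ring
        · have : w k = 0 := by
            change (if k = a then -Pc else if k = c then Pa else 0) = 0
            rw [if_neg hka, if_neg hkc]
          rw [if_neg hka, if_neg hkc, this]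
          apply smul_eq_zero_of_left
          ring
  · intro k
    by_cases hka : k = a
    · subst hka
      rw [hwa, if_pos (Or.inl rfl)]
      rcases mem_shiftedPart_cases _ hPc with h | ⟨j, hj, hjm⟩
      · exact Or.inl (by rw [h, neg_zero])
      -- `Pc` has degree `d c - b`, positive because `b < d c`; this is what makes the resolution
      -- minimal.
      · exact Or.inr ⟨j, by omega, by omega, neg_mem hjm⟩
    · by_cases hkc : k = c
      · subst hkc
        rw [hwc, if_pos (Or.inr rfl)]
        rcases mem_shiftedPart_cases _ hPa with h | ⟨j, hj, hjm⟩
        · exact Or.inl h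
        · exact Or.inr ⟨j, by omega, by omega, hjm⟩
      · left
        change (if k = a then -Pc else if k = c then Pa else 0) = 0
        rw [if_neg hka, if_neg hkc]

end HypArrangement

/-! ### From generators to freeness and SPOG, and Hilbert functions of `D(A)` -/

namespace HypArrangement

variable {K V : Type*} [Field K] [AddCommGroup V] [Module K V]
  {A : HypArrangement K V} {H : Submodule K V} {α : Module.Dual K V} {v : V}

theorem coe_sum_smul {ι : Type*} [Fintype ι]
    {N : Submodule (CoordRing K V) (Derivation K (CoordRing K V) (CoordRing K V))}
    (g : ι → CoordRing K V) (x : ι → N) :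
    ((∑ k, g k • x k : N) : Derivation K (CoordRing K V) (CoordRing K V)) =
      ∑ k, g k • (x k : Derivation K (CoordRing K V) (CoordRing K V)) :=
  map_sum N.subtype _ _

theorem mem_iff_of_basis {ι : Type*} [Fintype ι]
    {N : Submodule (CoordRing K V) (Derivation K (CoordRing K V) (CoordRing K V))}
    (b : Module.Basis ι (CoordRing K V) N) (θ : Derivation K (CoordRing K V) (CoordRing K V)) :
    θ ∈ N ↔ ∃ g : ι → CoordRing K V,
      θ = ∑ k, g k • (b k : Derivation K (CoordRing K V) (CoordRing K V)) := by
  constructor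
  · intro hθ
    refine ⟨fun k => b.repr ⟨θ, hθ⟩ k, ?_⟩
    rw [← coe_sum_smul, b.sum_repr]
  · rintro ⟨g, rfl⟩
    exact Submodule.sum_mem _ fun k _ => Submodule.smul_mem _ _ (b k).2

theorem eq_zero_of_basis {ι : Type*} [Fintype ι]
    {N : Submodule (CoordRing K V) (Derivation K (CoordRing K V) (CoordRing K V))}
    (b : Module.Basis ι (CoordRing K V) N) (g : ι → CoordRing K V)
    (h : ∑ k, g k • (b k : Derivation K (CoordRing K V) (CoordRing K V)) = 0) (k : ι) :
    g k = 0 := by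
  rw [← coe_sum_smul] at h
  have h1 : ∑ k, g k • b k = 0 := Subtype.ext h
  have h2 := DFunLike.congr_fun (congrArg b.repr h1) k
  rwa [b.repr_sum_self, map_zero] at h2

theorem isFreeWith_of_family {κ : Type*} [Fintype κ]
    {x : κ → Derivation K (CoordRing K V) (CoordRing K V)} {e : κ → ℕ}
    (hx : ∀ k, x k ∈ A.logDer) (hhom : ∀ k, IsHomogeneousOfDegree (x k) (e k))
    (hgen : ∀ θ ∈ A.logDer, ∃ g : κ → CoordRing K V, θ = ∑ k, g k • x k)
    (hli : ∀ g : κ → CoordRing K V, ∑ k, g k • x k = 0 → ∀ k, g k = 0) :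
    A.IsFreeWith (Finset.univ.val.map e) := by
  let y : κ → A.logDer := fun k => ⟨x k, hx k⟩
  have hy : LinearIndependent (CoordRing K V) y := by
    rw [Fintype.linearIndependent_iffₛ]
    intro f g hfg k
    refine sub_eq_zero.1 (hli (fun k => f k - g k) ?_ k)
    rw [sum_sub_smul, sub_eq_zero]
    exact (coe_sum_smul f y).symm.trans ((congrArg Subtype.val hfg).trans (coe_sum_smul g y))
  have hspan : ⊤ ≤ Submodule.span (CoordRing K V) (Set.range y) := by
    rintro ⟨θ, hθ⟩ -
    obtain ⟨g, hg⟩ := hgen θ hθ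
    have : (⟨θ, hθ⟩ : A.logDer) = ∑ k, g k • y k :=
      Subtype.ext (hg.trans (coe_sum_smul g y).symm)
    rw [this]
    exact Submodule.sum_mem _ fun k _ =>
      Submodule.smul_mem _ _ (Submodule.subset_span ⟨k, rfl⟩)
  let E := Fintype.equivFin κ
  refine ⟨Fintype.card κ, e ∘ E.symm, (Module.Basis.mk hy hspan).reindex E, ?_, ?_⟩
  · rw [← Multiset.map_map]
    congr 1
    have := congrArg Finset.val (Finset.map_univ_equiv E.symm)
    rwa [Finset.map_val] at this
  · intro k
    rw [Module.Basis.reindex_apply, Module.Basis.mk_apply]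
    exact hhom _

theorem map_univ_val_eq_cons {ι β : Type*} [Fintype ι] [DecidableEq ι] {a c : ι} (hac : a ≠ c)
    (g : ι → β) : Finset.univ.val.map g =
      g a ::ₘ g c ::ₘ ((Finset.univ \ {a, c} : Finset ι).val.map g) := by
  have hc : c ∉ Finset.univ \ {a, c} := by simp
  have ha : a ∉ insert c (Finset.univ \ {a, c}) := by simp [hac]
  have h : (Finset.univ : Finset ι) = insert a (insert c (Finset.univ \ {a, c})) := by
    ext k
    simp only [Finset.mem_univ, Finset.mem_insert, Finset.mem_sdiff, Finset.mem_singleton,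
      true_and, true_iff]
    tauto
  conv_lhs => rw [h]
  rw [Finset.insert_val_of_notMem ha, Finset.insert_val_of_notMem hc, Multiset.map_cons,
    Multiset.map_cons]

theorem map_univ_val_ite {ι : Type*} [Fintype ι] [DecidableEq ι] {a c : ι} (hac : a ≠ c)
    (d : ι → ℕ) : (Finset.univ.val.map fun k => if k = a ∨ k = c then d k + 1 else d k) =
      (d a + 1) ::ₘ (d c + 1) ::ₘ ((Finset.univ \ {a, c} : Finset ι).val.map d) := by
  rw [map_univ_val_eq_cons hac, if_pos (Or.inl rfl), if_pos (Or.inr rfl)]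
  congr 2
  apply Multiset.map_congr rfl
  intro k hk
  have hk' : k ∈ (Finset.univ \ {a, c} : Finset ι) := hk
  simp only [Finset.mem_sdiff, Finset.mem_univ, Finset.mem_insert, Finset.mem_singleton,
    true_and] at hk'
  rw [if_neg hk']

/-- Restriction to `H` kills `α θ_a` and `α θ_c`, so `φ` and the remaining `Φ k` still generate. A
relation between their restrictions lifts to a combination lying in `α D(A')`, and `hred` makes its
coefficients vanish on `H`. -/
theorem isFreeWith_restriction_of_generators (hH : H ∈ A.hyperplanes)
    (hα : LinearMap.ker α = H) (hv : α v = 1) {ι : Type*} [Fintype ι] [DecidableEq ι]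
    {θ Φ : ι → Derivation K (CoordRing K V) (CoordRing K V)}
    {φ : Derivation K (CoordRing K V) (CoordRing K V)} {e : ι → ℕ} {δ : ℕ} {a c : ι}
    (hsurj : ∀ η ∈ (A.restriction H hH).logDer, ∃ θ ∈ A.logDer, restrictDer hα hv θ = η)
    (hΦ : ∀ k, Φ k ∈ A.logDer) (hφ : φ ∈ A.logDer)
    (hΦhom : ∀ k, k ≠ a → k ≠ c → IsHomogeneousOfDegree (Φ k) (e k))
    (hφhom : IsHomogeneousOfDegree φ δ)
    (hΦa : Φ a = form α • θ a) (hΦc : Φ c = form α • θ c)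
    (hgen : ∀ ζ ∈ A.logDer, ∃ (g : ι → CoordRing K V) (t : CoordRing K V),
        ζ = ∑ k, g k • Φ k + t • φ)
    (hred : ∀ (g : ι → CoordRing K V) (t : CoordRing K V), ∀ η ∈ (A.deletion H).logDer,
        ∑ k, g k • Φ k + t • φ = form α • η →
          (∀ k, k ≠ a → k ≠ c → form α ∣ g k) ∧ form α ∣ t) :
    (A.restriction H hH).IsFreeWith
      ((Finset.univ \ {a, c} : Finset ι).val.map e + {δ}) := by
  have h0 : α ≠ 0 := ne_zero_of_isCoatom_ker (by rw [hα]; exact A.isCoatom H hH)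
  let s : Finset ι := Finset.univ \ {a, c}
  have hs : ∀ {k}, k ∈ s ↔ k ≠ a ∧ k ≠ c := by
    intro k
    simp only [s, Finset.mem_sdiff, Finset.mem_univ, Finset.mem_insert, Finset.mem_singleton,
      true_and, not_or]
  let x : Option s → Derivation K (CoordRing K V) (CoordRing K V) := fun o => o.elim φ fun k => Φ k
  let e' : Option s → ℕ := fun o => o.elim δ fun k => e k
  have hE : (Finset.univ.val.map e' : Multiset ℕ) = s.val.map e + {δ} := by
    rw [add_comm, Multiset.singleton_add]
    change Multiset.map e' (none ::ₘ (Finset.univ.val.map some)) = _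
    rw [Multiset.map_cons, Multiset.map_map]
    congr 1
    exact Multiset.attach_map_val' s.val e
  rw [← hE]
  have hxmem : ∀ o, x o ∈ A.logDer := by
    rintro (_ | k)
    exacts [hφ, hΦ k]
  refine isFreeWith_of_family (x := fun o => restrictDer hα hv (x o))
    (fun o => restrictDer_mem hH hα hv (hxmem o)) ?_ ?_ ?_
  · rintro (_ | k)
    · exact isHomogeneousOfDegree_restrictDer hα hv hφhom
    · exact isHomogeneousOfDegree_restrictDer hα hv
        (hΦhom k (hs.1 k.2).1 (hs.1 k.2).2)
  · intro η hη
    obtain ⟨ζ, hζ, rfl⟩ := hsurj η hη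
    obtain ⟨g, t, rfl⟩ := hgen ζ hζ
    refine ⟨fun o => o.elim (pullback H.subtype t) fun k => pullback H.subtype (g k), ?_⟩
    rw [Fintype.sum_option, map_add, restrictDer_smul, restrictDer_sum, add_comm]
    congr 1
    rw [← Finset.sum_subset (Finset.subset_univ s), ← Finset.sum_coe_sort]
    · rfl
    · intro k _ hk
      have : restrictDer hα hv (Φ k) = 0 := by
        by_cases hka : k = a
        · rw [hka, hΦa, restrictDer_smul, pullback_subtype_form hα, zero_smul]
        · by_cases hkc : k = c
          · rw [hkc, hΦc, restrictDer_smul, pullback_subtype_form hα, zero_smul]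
          · exact absurd (hs.2 ⟨hka, hkc⟩) hk
      rw [this, smul_zero]
  · intro h hh
    choose g hg using fun o => pullback_subtype_surjective hα h0 (h o)
    have hζ : (∑ o, g o • x o) ∈ A.logDer :=
      Submodule.sum_mem _ fun o _ => Submodule.smul_mem _ _ (hxmem o)
    obtain ⟨η, hη, heq⟩ := (restrictDer_eq_zero_iff hH hα hv hζ).1 (by
      rw [restrictDer_sum]
      simpa only [hg] using hh)
    let G : ι → CoordRing K V := fun k => if hk : k ∈ s then g (some ⟨k, hk⟩) else 0
    have hG : ∀ k : s, G k = g (some k) := fun k => dif_pos k.2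
    obtain ⟨h1, h2⟩ := hred G (g none) η hη (by
      rw [← heq, Fintype.sum_option, add_comm]
      congr 1
      rw [← Finset.sum_subset (Finset.subset_univ s), ← Finset.sum_coe_sort]
      · exact Finset.sum_congr rfl fun k _ => by rw [hG]; rfl
      · intro k _ hk
        rw [show G k = 0 from dif_neg hk, zero_smul])
    rintro (_ | k)
    · rw [← hg]
      exact (pullback_subtype_eq_zero_iff hα h0).2 h2
    · rw [← hg, ← hG]
      exact (pullback_subtype_eq_zero_iff hα h0).2 (h1 k (hs.1 k.2).1 (hs.1 k.2).2)

/-- The resolution sends `1` to the relation `(w, α)`. It is injective because `α ≠ 0`, and minimal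
because the nonzero entries have positive degree. -/
theorem isSPOGWith_of_generators {r : ℕ} {e : Fin r → ℕ} {δ : ℕ} (hα0 : α ≠ 0)
    {Φ : Fin r → Derivation K (CoordRing K V) (CoordRing K V)}
    {φ : Derivation K (CoordRing K V) (CoordRing K V)} {w : Fin r → CoordRing K V}
    (hE : 1 ∈ (Finset.univ.val.map e : Multiset ℕ))
    (hΦ : ∀ k, Φ k ∈ A.logDer) (hφ : φ ∈ A.logDer)
    (hΦhom : ∀ k, IsHomogeneousOfDegree (Φ k) (e k)) (hφhom : IsHomogeneousOfDegree φ δ)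
    (hgen : ∀ ζ ∈ A.logDer, ∃ (g : Fin r → CoordRing K V) (t : CoordRing K V),
        ζ = ∑ k, g k • Φ k + t • φ)
    (hrel : ∀ (g : Fin r → CoordRing K V) (t : CoordRing K V), ∑ k, g k • Φ k + t • φ = 0 ↔
        ∃ s, t = s * form α ∧ ∀ k, g k = s * w k)
    (hw : ∀ k, w k = 0 ∨ ∃ j, 0 < j ∧ e k + j = δ + 1 ∧ w k ∈ homogeneousPart K V j) :
    A.IsSPOGWith (Finset.univ.val.map e) δ := by
  let Φ' : Fin r → A.logDer := fun k => ⟨Φ k, hΦ k⟩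
  let φ' : A.logDer := ⟨φ, hφ⟩
  let ψ : CoordRing K V →ₗ[CoordRing K V] (Fin r → CoordRing K V) × CoordRing K V :=
    LinearMap.toSpanSingleton _ _ (w, form α)
  let π : (Fin r → CoordRing K V) × CoordRing K V →ₗ[CoordRing K V] A.logDer :=
    LinearMap.coprod (Fintype.linearCombination (CoordRing K V) Φ')
      (LinearMap.toSpanSingleton _ _ φ')
  have hψ : ∀ s, ψ s = (fun k => s * w k, s * form α) := fun s => rfl
  have hψ1 : ψ 1 = (w, form α) := by
    rw [hψ]
    simp only [one_mul]
  have hπ : ∀ y, (π y : Derivation K (CoordRing K V) (CoordRing K V)) =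
      ∑ k, y.1 k • Φ k + y.2 • φ := fun y =>
    congrArg (· + y.2 • φ) (coe_sum_smul y.1 Φ')
  have hα1 := (prime_form hα0).ne_zero
  refine ⟨hE, r, e, ψ, π, rfl, ?_, ?_, ?_, ?_, ?_, ?_, ?_, ?_, ?_⟩
  · intro s t hst
    rw [hψ, hψ] at hst
    exact mul_right_cancel₀ hα1 (congrArg Prod.snd hst)
  · rintro ⟨g, t⟩
    rw [← Subtype.coe_inj, hπ]
    change ∑ k, g k • Φ k + t • φ = 0 ↔ _
    rw [hrel]
    constructor
    · rintro ⟨s, rfl, hs⟩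
      exact ⟨s, Prod.ext (funext fun k => (hs k).symm) rfl⟩
    · rintro ⟨s, hs⟩
      rw [hψ] at hs
      exact ⟨s, (congrArg Prod.snd hs).symm, fun k =>
        (congrFun (congrArg Prod.fst hs) k).symm⟩
  · rintro ⟨ζ, hζ⟩
    obtain ⟨g, t, rfl⟩ := hgen ζ hζ
    exact ⟨(g, t), Subtype.ext (hπ _)⟩
  · intro k
    rw [hπ]
    convert hΦhom k
    change ∑ j, (Pi.single k 1 : Fin r → CoordRing K V) j • Φ j + (0 : CoordRing K V) • φ = Φ k
    rw [zero_smul, add_zero, Finset.sum_eq_single k, Pi.single_eq_same, one_smul]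
    · intro j _ hj
      rw [Pi.single_eq_of_ne hj, zero_smul]
    · exact fun h => absurd (Finset.mem_univ k) h
  · rw [hπ]
    convert hφhom
    change ∑ j, (0 : CoordRing K V) • Φ j + (1 : CoordRing K V) • φ = φ
    rw [one_smul, Finset.sum_eq_zero fun j _ => zero_smul _ _, zero_add]
  · intro k
    rw [hψ1]
    rcases hw k with h | ⟨j, -, hj, hjm⟩
    · exact Or.inl h
    · exact Or.inr ⟨j, hj, hjm⟩
  · rw [hψ1]
    exact form_mem α
  · intro k
    rw [hψ1]
    rcases hw k with h | ⟨j, hj0, -, hjm⟩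
    · change w k ∈ _
      rw [h]
      exact zero_mem _
    · exact homogeneousPart_le_span hj0 hjm
  · rw [hψ1]
    exact homogeneousPart_le_span one_pos (form_mem α)

theorem IsSPOGWith.finrank_gradedPart [FiniteDimensional K V] {E : Multiset ℕ} {δ : ℕ}
    (h : A.IsSPOGWith E δ) (m : ℕ) :
    Module.finrank K (gradedPart A.logDer m) +
      Module.finrank K (shiftedPart (homogeneousPart K V) (δ + 1) m) =
      Module.finrank K (shiftedPart (homogeneousPart K V) δ m) +
      (E.map fun e => Module.finrank K (shiftedPart (homogeneousPart K V) e m)).sum := by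
  obtain ⟨-, r, e, ψ, π, rfl, hinj, hex, hsurj, hhom, hhom', hw, hw', -, -⟩ := h
  let Φ : Option (Fin r) → Derivation K (CoordRing K V) (CoordRing K V) := fun o =>
    o.elim (π (0, 1) : Derivation K (CoordRing K V) (CoordRing K V)) fun k => π (Pi.single k 1, 0)
  let e' : Option (Fin r) → ℕ := fun o => o.elim δ e
  let w : Option (Fin r) → CoordRing K V := fun o => o.elim (ψ 1).2 (ψ 1).1
  have hΦ : ∀ g : Option (Fin r) → CoordRing K V, ∑ o, g o • Φ o =
      (π (fun k => g (some k), g none) : Derivation K (CoordRing K V) (CoordRing K V)) := by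
    intro g
    have hy : ((fun k => g (some k), g none) : (Fin r → CoordRing K V) × CoordRing K V) =
        g none • (0, 1) + ∑ k, g (some k) • (Pi.single k 1, 0) := by
      refine Prod.ext ?_ ?_
      · rw [Prod.fst_add, Prod.fst_sum]
        funext j
        rw [Pi.add_apply, Finset.sum_apply, Finset.sum_eq_single j]
        · change g (some j) = g none * 0 + g (some j) * (Pi.single j 1 : Fin r → CoordRing K V) j
          rw [Pi.single_eq_same, mul_zero, mul_one, zero_add]
        · intro k _ hk
          change g (some k) * (Pi.single k 1 : Fin r → CoordRing K V) j = 0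
          rw [Pi.single_eq_of_ne hk.symm, mul_zero]
        · exact fun h => absurd (Finset.mem_univ j) h
      · rw [Prod.snd_add, Prod.snd_sum]
        change g none = g none * 1 + ∑ k, g (some k) * 0
        rw [mul_one, Finset.sum_eq_zero fun k _ => mul_zero _, add_zero]
    rw [Fintype.sum_option, hy, map_add, map_sum, map_smul]
    change _ = g none • (π (0, 1) : Derivation K (CoordRing K V) (CoordRing K V)) +
      ((∑ k, π (g (some k) • (Pi.single k 1, 0)) : A.logDer) :
        Derivation K (CoordRing K V) (CoordRing K V))
    rw [Finset.sum_congr rfl fun k _ => map_smul π (g (some k)) (Pi.single k 1, 0),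
      coe_sum_smul]
    rfl
  have key := finrank_gradedPart_of_relation (φ := Φ) (e := e') (N := A.logDer) (w := w)
    (D := δ + 1) ?_ ?_ ?_ ?_ ?_ m
  · rw [key, Fintype.sum_option, Multiset.map_map]
    rfl
  · rintro (_ | k)
    exacts [hhom', hhom k]
  · intro θ
    constructor
    · intro hθ
      obtain ⟨⟨g, t⟩, hgt⟩ := hsurj ⟨θ, hθ⟩
      refine ⟨fun o => o.elim t g, ?_⟩
      rw [hΦ]
      exact (congrArg Subtype.val hgt).symm
    · rintro ⟨g, rfl⟩
      rw [hΦ]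
      exact SetLike.coe_mem _
  · rintro (_ | k)
    · exact mem_shiftedPart _ hw' (Nat.add_comm _ _)
    · rcases hw k with h | ⟨j, hj, hjm⟩
      · change (ψ 1).1 k ∈ _
        rw [h]
        exact zero_mem _
      · exact mem_shiftedPart _ hjm (by rw [Nat.add_comm]; exact hj)
  · intro hw0
    have h1 : ψ 1 = 0 := Prod.ext (funext fun k => congrFun hw0 (some k)) (congrFun hw0 none)
    exact one_ne_zero (hinj (h1.trans (map_zero ψ).symm))
  · intro g
    rw [hΦ, ← Submodule.coe_zero (p := A.logDer), Subtype.coe_inj, hex]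
    have hψ : ∀ t, ψ t = (fun k => t * w (some k), t * w none) := by
      intro t
      have : ψ t = t • ψ 1 := by rw [← map_smul, smul_eq_mul, mul_one]
      rw [this]
      rfl
    constructor
    · rintro ⟨t, ht⟩
      rw [hψ] at ht
      refine ⟨t, ?_⟩
      rintro (_ | k)
      · exact (congrArg Prod.snd ht).symm
      · exact (congrFun (congrArg Prod.fst ht) k).symm
    · rintro ⟨t, ht⟩
      exact ⟨t, by rw [hψ]; exact Prod.ext (funext fun k => (ht (some k)).symm) (ht none).symm⟩

theorem IsFreeWith.finrank_gradedPart [FiniteDimensional K V] {E : Multiset ℕ}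
    (h : A.IsFreeWith E) (m : ℕ) :
    Module.finrank K (gradedPart A.logDer m) =
      (E.map fun e => Module.finrank K (shiftedPart (homogeneousPart K V) e m)).sum := by
  obtain ⟨r, e, b, rfl, hhom⟩ := h
  rw [finrank_gradedPart_of_linearIndependent hhom (mem_iff_of_basis b) (eq_zero_of_basis b),
    Multiset.map_map]
  rfl

end HypArrangement

/-! ### The boundary ideal and the two dimension counts -/

namespace HypArrangement

section Dimensions

variable {K V : Type*} [Field K] [AddCommGroup V] [Module K V]
  {A : HypArrangement K V} {H : Submodule K V} {α : Module.Dual K V} {v : V}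

/-- The value of a derivation at `α`, restricted to the hyperplane `H`. -/
noncomputable def boundaryValue (H : Submodule K V) (α : Module.Dual K V) :
    Derivation K (CoordRing K V) (CoordRing K V) →ₗ[K] CoordRing K H where
  toFun θ := pullback H.subtype (θ (form α))
  map_add' θ η := by rw [Derivation.add_apply, map_add]
  map_smul' c θ := by rw [Derivation.smul_apply, map_smul, RingHom.id_apply]

theorem boundaryValue_apply (θ : Derivation K (CoordRing K V) (CoordRing K V)) :
    boundaryValue H α θ = pullback H.subtype (θ (form α)) := rfl

theorem decompose_pullback {W : Type*} [AddCommGroup W] [Module K W] (f : V →ₗ[K] W) (m : ℕ)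
    (x : CoordRing K W) : (DirectSum.decompose (homogeneousPart K V) (pullback f x) m :
      CoordRing K V) = pullback f (DirectSum.decompose (homogeneousPart K W) x m) := by
  induction x using DirectSum.Decomposition.inductionOn (homogeneousPart K W) with
  | zero => simp
  | @homogeneous i x =>
    by_cases h : i = m
    · subst h
      rw [DirectSum.decompose_of_mem_same _ (pullback_mem f x.2),
        DirectSum.decompose_of_mem_same _ x.2]
    · rw [DirectSum.decompose_of_mem_ne _ (pullback_mem f x.2) h,
        DirectSum.decompose_of_mem_ne _ x.2 h, map_zero]
  | add x y hx hy =>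
    rw [map_add, DirectSum.decompose_add, DirectSum.decompose_add, DirectSum.add_apply,
      DirectSum.add_apply, Submodule.coe_add, Submodule.coe_add, map_add, hx, hy]

theorem dvd_decompose {γ : Module.Dual K V} {x : CoordRing K V} (h : form γ ∣ x) (m : ℕ) :
    form γ ∣ (DirectSum.decompose (homogeneousPart K V) x m : CoordRing K V) := by
  obtain ⟨y, rfl⟩ := h
  rw [mul_comm, decompose_mul_of_mem _ m y (form_mem γ)]
  exact Dvd.intro_left _ rfl

/-- The homogeneous component of degree `m` of a derivation. -/
noncomputable def derComponent (m : ℕ) (θ : Derivation K (CoordRing K V) (CoordRing K V)) :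
    Derivation K (CoordRing K V) (CoordRing K V) :=
  derivationOf (GradedAlgebra.proj (homogeneousPart K V) m ∘ₗ θ.toLinearMap ∘ₗ
    SymmetricAlgebra.ι K (Module.Dual K V))

theorem derComponent_form (m : ℕ) (θ : Derivation K (CoordRing K V) (CoordRing K V))
    (γ : Module.Dual K V) : derComponent m θ (form γ) =
      DirectSum.decompose (homogeneousPart K V) (θ (form γ)) m := by
  rw [derComponent, derivationOf_form]
  rfl

theorem derComponent_mem {m : ℕ} {θ : Derivation K (CoordRing K V) (CoordRing K V)}
    (hθ : θ ∈ A.logDer) : derComponent m θ ∈ gradedPart A.logDer m := by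
  refine mem_gradedPart.2 ⟨fun γ => ?_, fun γ hγ => ?_⟩
  · rw [derComponent_form]
    exact SetLike.coe_mem _
  · rw [derComponent_form]
    exact dvd_decompose (hθ γ hγ) m

variable {ι : Type*} [Fintype ι] {θ : ι → Derivation K (CoordRing K V) (CoordRing K V)}
  {e : ι → ℕ}

/-- Coefficients over `S_H` lift to homogeneous coefficients over `S`. This puts the image in the
form that `exists_two_generators` requires. -/
theorem mem_map_boundaryValue_iff (hα : LinearMap.ker α = H) (h0 : α ≠ 0)
    {N : Submodule (CoordRing K V) (Derivation K (CoordRing K V) (CoordRing K V))}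
    (hhom : ∀ k, IsHomogeneousOfDegree (θ k) (e k))
    (hθ : ∀ ζ, ζ ∈ N ↔ ∃ g : ι → CoordRing K V, ζ = ∑ k, g k • θ k) (m : ℕ)
    (x : CoordRing K H) : x ∈ (gradedPart N m).map (boundaryValue H α) ↔
      ∃ g : ι → CoordRing K H, (∀ k, g k ∈ shiftedPart (homogeneousPart K H) (e k) m) ∧
        x = ∑ k, g k * boundaryValue H α (θ k) := by
  have hsum : ∀ g : ι → CoordRing K V, boundaryValue H α (∑ k, g k • θ k) =
      ∑ k, pullback H.subtype (g k) * boundaryValue H α (θ k) := by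
    intro g
    rw [boundaryValue_apply, sum_smul_apply, map_sum]
    exact Finset.sum_congr rfl fun k _ => map_mul _ _ _
  rw [← range_combination hhom hθ]
  constructor
  · rintro ⟨_, ⟨g, rfl⟩, rfl⟩
    exact ⟨fun k => pullback H.subtype (g k), fun k => pullback_mem_shiftedPart (g k).2, hsum _⟩
  · rintro ⟨g, hg, rfl⟩
    choose g' hg' hgg using fun k => exists_shifted_lift hα h0 (hg k)
    refine ⟨_, ⟨fun k => ⟨g' k, hg' k⟩, rfl⟩, ?_⟩
    rw [combination_apply, hsum]
    simp only [hgg]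

variable [FiniteDimensional K V]

/-- Degree `m` of `0 → D(A) → D(A') → I → 0`. -/
theorem finrank_map_boundaryValue (hH : H ∈ A.hyperplanes) (hα : LinearMap.ker α = H)
    (hhom : ∀ k, IsHomogeneousOfDegree (θ k) (e k))
    (hθ : ∀ ζ, ζ ∈ (A.deletion H).logDer ↔ ∃ g : ι → CoordRing K V, ζ = ∑ k, g k • θ k) (m : ℕ) :
    Module.finrank K ((gradedPart (A.deletion H).logDer m).map (boundaryValue H α)) +
      Module.finrank K (gradedPart A.logDer m) =
      Module.finrank K (gradedPart (A.deletion H).logDer m) := by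
  have h0 : α ≠ 0 := ne_zero_of_isCoatom_ker (by rw [hα]; exact A.isCoatom H hH)
  have := finiteDimensional_gradedPart hhom hθ m
  apply finrank_map_add_of_ker
  · rintro ζ ⟨h1, h2⟩
    exact ⟨h1, ((mem_logDer_iff hH hα).1 h2).1⟩
  · rintro ζ ⟨h1, h2⟩
    rw [boundaryValue_apply, pullback_subtype_eq_zero_iff hα h0, mem_gradedPart,
      mem_logDer_iff hH hα]
    exact ⟨fun h => ⟨h1, h2, h⟩, fun h => h.2.2⟩

/-- Degree `m` of `0 → α D(A') → D(A) → D(A^H) → 0`; the submodule `α D(A')` has the basis `α θ_k`,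
of degrees `e k + 1`. -/
theorem finrank_gradedPart_restriction (hH : H ∈ A.hyperplanes) (hα : LinearMap.ker α = H)
    (hv : α v = 1) (hhom : ∀ k, IsHomogeneousOfDegree (θ k) (e k))
    (hθ : ∀ ζ, ζ ∈ (A.deletion H).logDer ↔ ∃ g : ι → CoordRing K V, ζ = ∑ k, g k • θ k)
    (hli : ∀ g : ι → CoordRing K V, ∑ k, g k • θ k = 0 → ∀ k, g k = 0)
    (hsurj : ∀ η ∈ (A.restriction H hH).logDer, ∃ θ ∈ A.logDer, restrictDer hα hv θ = η)
    (m : ℕ) :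
    Module.finrank K (gradedPart (A.restriction H hH).logDer m) +
      ∑ k, Module.finrank K (shiftedPart (homogeneousPart K V) (e k + 1) m) =
      Module.finrank K (gradedPart A.logDer m) := by
  have h0 : α ≠ 0 := ne_zero_of_isCoatom_ker (by rw [hα]; exact A.isCoatom H hH)
  let N : Submodule (CoordRing K V) (Derivation K (CoordRing K V) (CoordRing K V)) :=
    Submodule.span (CoordRing K V) (Set.range fun k => form α • θ k)
  have hN : ∀ ζ, ζ ∈ N ↔ ∃ g : ι → CoordRing K V, ζ = ∑ k, g k • form α • θ k := by
    intro ζ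
    rw [Submodule.mem_span_range_iff_exists_fun]
    exact exists_congr fun g => eq_comm
  have hcomm : ∀ g : ι → CoordRing K V,
      ∑ k, g k • form α • θ k = form α • ∑ k, g k • θ k := by
    intro g
    rw [Finset.smul_sum]
    exact Finset.sum_congr rfl fun k _ => smul_comm _ _ _
  have hNM : ∀ ζ, ζ ∈ N ↔ ∃ η ∈ (A.deletion H).logDer, ζ = form α • η := by
    intro ζ
    rw [hN]
    constructor
    · rintro ⟨g, rfl⟩
      exact ⟨_, (hθ _).2 ⟨g, rfl⟩, hcomm g⟩
    · rintro ⟨η, hη, rfl⟩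
      obtain ⟨g, rfl⟩ := (hθ η).1 hη
      exact ⟨g, (hcomm g).symm⟩
  have hdimN : Module.finrank K (gradedPart N m) =
      ∑ k, Module.finrank K (shiftedPart (homogeneousPart K V) (e k + 1) m) := by
    refine finrank_gradedPart_of_linearIndependent (φ := fun k => form α • θ k) (fun k =>
      isHomogeneousOfDegree_smul (hhom k)
        (mem_shiftedPart _ (form_mem α) (Nat.add_comm _ _))) hN ?_ m
    intro g hg k
    rw [hcomm, ← sum_mul_smul] at hg
    exact (mul_eq_zero.1 (hli _ hg k)).resolve_left (prime_form h0).ne_zero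
  have hmap : (gradedPart A.logDer m).map (restrictDer hα hv) =
      gradedPart (A.restriction H hH).logDer m := by
    apply le_antisymm
    · rintro _ ⟨ζ, ⟨h1, h2⟩, rfl⟩
      exact ⟨isHomogeneousOfDegree_restrictDer hα hv h1, restrictDer_mem hH hα hv h2⟩
    · rintro η ⟨h1, h2⟩
      obtain ⟨ζ, hζ, rfl⟩ := hsurj η h2
      -- A lift of a homogeneous derivation need not be homogeneous, but its component of degree `m`
      -- is again a lift.
      refine ⟨derComponent m ζ, derComponent_mem hζ, derivation_ext fun γ => ?_⟩
      rw [restrictDer_form, derComponent_form, ← decompose_pullback, ← restrictDer_form,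
        DirectSum.decompose_of_mem_same _ (h1 γ)]
  have : FiniteDimensional K (gradedPart A.logDer m) := by
    have := finiteDimensional_gradedPart hhom hθ m
    apply Submodule.finiteDimensional_of_le (S₂ := gradedPart (A.deletion H).logDer m)
    rintro ζ ⟨h1, h2⟩
    exact ⟨h1, ((mem_logDer_iff hH hα).1 h2).1⟩
  rw [← hmap, ← hdimN]
  apply finrank_map_add_of_ker
  · rintro ζ ⟨h1, h2⟩
    obtain ⟨η, hη, rfl⟩ := (hNM ζ).1 h2
    exact ⟨h1, smul_mem_logDer hH hα hη⟩
  · rintro ζ ⟨h1, h2⟩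
    rw [restrictDer_eq_zero_iff hH hα hv h2, mem_gradedPart, hNM]
    exact ⟨fun h => ⟨h1, h⟩, fun h => h.2⟩

end Dimensions

end HypArrangement

/-! ### The equivalence -/

open HypArrangement

theorem corollary4p1 {K V : Type*} [Field K] [AddCommGroup V] [Module K V]
    [FiniteDimensional K V] (n : ℕ) (hV : Module.finrank K V = n + 1)
    (A : HypArrangement K V) (H : Submodule K V) (hH : H ∈ A.hyperplanes)
    -- the exponents `1, d₂ ≤ … ≤ d_ℓ` of the deletion, where `ℓ = n + 1` and `dₖ` is `d (k - 1)`
    (d : Fin (n + 1) → ℕ) (hd_one : d 0 = 1)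
    (hd_mono : ∀ j k : Fin (n + 1), j ≠ 0 → j ≤ k → d j ≤ d k)
    (hfree : (A.deletion H).IsFreeWith (Finset.univ.val.map d))
    (i : Fin (n + 1)) (hi_ne_zero : i ≠ 0) (hi_ne_last : i ≠ Fin.last n)
    (δ : ℕ)
    (hδ : (δ : ℤ) = d i + d (Fin.last n) + (A.restriction H hH).card - (A.deletion H).card)
    (hδ_gt : d (Fin.last n) < δ) :
    (A.restriction H hH).IsFreeWith
        ((Finset.univ \ {i, Fin.last n}).val.map d + {δ}) ↔
      A.IsSPOGWith
        (Finset.univ.val.map fun k => if k = i ∨ k = Fin.last n then d k + 1 else d k) δ := by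
  have hHc := A.isCoatom H hH
  obtain ⟨α, hα⟩ := exists_ker_eq hHc
  have h0 : α ≠ 0 := ne_zero_of_isCoatom_ker (by rwa [hα])
  obtain ⟨v, hv⟩ := exists_apply_eq_one h0
  have hn : 2 ≤ n := by
    have h1 : (i : ℕ) ≠ 0 := fun h => hi_ne_zero (Fin.ext h)
    have h2 : (i : ℕ) ≠ n := fun h => hi_ne_last (Fin.ext h)
    omega
  have hlast0 : (0 : Fin (n + 1)) ≠ Fin.last n := fun h => by
    have := congrArg Fin.val h
    simp only [Fin.val_zero, Fin.val_last] at this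
    omega
  have : Nontrivial H := by
    have h1 := Module.Dual.finrank_ker_add_one_of_ne_zero h0
    rw [hα, hV] at h1
    exact Module.nontrivial_of_finrank_pos (R := K) (by omega)
  obtain ⟨B, b, hb, hB0, hBm, hBd⟩ := exists_common_divisor hH hα hv
  have hdil : d i ≤ d (Fin.last n) := hd_mono _ _ hi_ne_zero (Fin.le_last i)
  have hδb : δ + b = d i + d (Fin.last n) := by omega
  have hdim' := hfree.finrank_gradedPart
  obtain ⟨r, e, bs, he, hhom⟩ := hfree
  have hθ := mem_iff_of_basis bs
  have hli := eq_zero_of_basis bs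
  set θ : Fin r → Derivation K (CoordRing K V) (CoordRing K V) := fun k => bs k
  have hsurj : ∀ η ∈ (A.restriction H hH).logDer, ∃ θ ∈ A.logDer, restrictDer hα hv θ = η :=
    fun η hη => restrictDer_surjective hH hα hv hθ hli hη
  have hde : ∀ k, e k ≤ d (Fin.last n) := by
    intro k
    have h1 : e k ∈ (Finset.univ.val.map d : Multiset ℕ) := by
      rw [← he]
      exact Multiset.mem_map_of_mem _ (Finset.mem_univ k)
    obtain ⟨j, -, hj⟩ := Multiset.mem_map.1 h1
    rw [← hj]
    by_cases hj0 : j = 0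
    · rw [hj0, hd_one]
      -- The exponent `1` is not part of the ordering hypothesis. From `d_ℓ < δ` and `δ + b = d_i +
      -- d_ℓ` follows `b < d_i ≤ d_ℓ`, so `1 ≤ d_ℓ`.
      omega
    · exact hd_mono _ _ hj0 (Fin.le_last j)
  let F : Fin r → CoordRing K H := fun k => boundaryValue H α (θ k)
  have hFm : ∀ k, F k ∈ homogeneousPart K H (e k) := fun k => pullback_mem _ (hhom k α)
  choose f hf using fun k => hBd (θ k) (bs k).2
  have hfm : ∀ k, f k ∈ shiftedPart (homogeneousPart K H) b (e k) := by
    intro k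
    apply mem_shiftedPart_of_mul_mem _ hBm hB0
    rw [mul_comm, ← hf]
    exact hFm k
  let s : ℕ → ℕ → ℕ := fun x m => Module.finrank K (shiftedPart (homogeneousPart K V) x m)
  let t : ℕ → ℕ → ℕ := fun x m => Module.finrank K (shiftedPart (homogeneousPart K H) x m)
  have hts : ∀ x m, t x m + s (x + 1) m = s x m := finrank_shiftedPart_hyperplane hα h0
  let I : ℕ → Submodule K (CoordRing K H) := fun m =>
    (gradedPart (A.deletion H).logDer m).map (boundaryValue H α)
  have hI : ∀ m, Module.finrank K (I m) + Module.finrank K (gradedPart A.logDer m) =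
      s (d i) m + (s (d (Fin.last n)) m +
        (((Finset.univ \ {i, Fin.last n} : Finset (Fin (n + 1))).val.map d).map
          fun x => s x m).sum) := by
    intro m
    rw [finrank_map_boundaryValue hH hα hhom hθ m, hdim', map_univ_val_eq_cons hi_ne_last,
      Multiset.map_cons, Multiset.map_cons, Multiset.sum_cons, Multiset.sum_cons]
  -- The pivot of the equivalence: this Hilbert function of the boundary ideal yields both
  -- conditions at once, and below each of them is shown to force it.
  have key : (∀ m, Module.finrank K (I m) + t δ m = t (d i) m + t (d (Fin.last n)) m) →
      (A.restriction H hH).IsFreeWith ((Finset.univ \ {i, Fin.last n}).val.map d + {δ}) ∧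
      A.IsSPOGWith
        (Finset.univ.val.map fun k => if k = i ∨ k = Fin.last n then d k + 1 else d k) δ := by
    intro hdim
    obtain ⟨a, c, hac, hea, hec, -, hFc, hgen, hsyz⟩ := exists_two_generators
      (homogeneousPart K H) finrank_homogeneousPart_zero hFm hB0 hf hfm hdil hδ_gt hδb hde
      (mem_map_boundaryValue_iff hα h0 hhom hθ) hdim
    obtain ⟨Φ, φ, w, hΦ, hφ, hΦh, hφh, hΦa, hΦc, hgen', hred, hrel, hw⟩ :=
      exists_generators hH hα hhom hθ hli (F := F) (fun k => rfl) hf hfm hac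
        (by rw [hea, hec]; exact hδb) (by omega) (by omega) hFc
        (by rw [hea, hec]; exact hgen) hsyz
    have hrest : ((Finset.univ \ {a, c} : Finset (Fin r)).val.map e) =
        (Finset.univ \ {i, Fin.last n} : Finset (Fin (n + 1))).val.map d := by
      rw [map_univ_val_eq_cons hac, map_univ_val_eq_cons hi_ne_last, hea, hec,
        Multiset.cons_inj_right, Multiset.cons_inj_right] at he
      exact he
    constructor
    · rw [← hrest]
      refine isFreeWith_restriction_of_generators (θ := θ) hH hα hv hsurj hΦ hφ (fun k hka hkc => ?_) hφh
        hΦa hΦc hgen' hred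
      have := hΦh k
      rwa [if_neg (by tauto)] at this
    · have hE : (Finset.univ.val.map fun k => if k = i ∨ k = Fin.last n then d k + 1 else d k) =
          Finset.univ.val.map fun k => if k = a ∨ k = c then e k + 1 else e k := by
        rw [map_univ_val_ite hi_ne_last, map_univ_val_ite hac, hea, hec, hrest]
      rw [hE]
      refine isSPOGWith_of_generators h0 ?_ hΦ hφ hΦh hφh hgen' hrel hw
      rw [← hE]
      -- The exponent `1` at index `0` survives, as `0` is neither `i` nor the last index.
      refine Multiset.mem_map.2 ⟨0, Finset.mem_univ_val _, ?_⟩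
      rw [if_neg (by
        rintro (h | h)
        exacts [hi_ne_zero h.symm, hlast0 h]), hd_one]
  constructor
  -- `dim I = dim D(A') - dim α D(A') - dim D(A^H)`. By `hts` the first difference is the sum of `t`
  -- over all exponents of `A'`; the exponents shared with `A^H` cancel.
  · intro hres
    refine (key fun m => ?_).2
    have h1 := hI m
    rw [← finrank_gradedPart_restriction hH hα hv hhom hθ hli hsurj m, hres.finrank_gradedPart,
      Multiset.map_add, Multiset.sum_add, Multiset.map_singleton, Multiset.sum_singleton] at h1
    have h2 : ∑ k, Module.finrank K (shiftedPart (homogeneousPart K V) (e k + 1) m) =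
        s (d i + 1) m + (s (d (Fin.last n) + 1) m +
        (((Finset.univ \ {i, Fin.last n} : Finset (Fin (n + 1))).val.map d).map
          fun x => s (x + 1) m).sum) := by
      have h3 : ∑ k, Module.finrank K (shiftedPart (homogeneousPart K V) (e k + 1) m) =
          ((Finset.univ.val.map e).map fun x => s (x + 1) m).sum := by
        rw [Multiset.map_map]
        rfl
      rw [h3, he, map_univ_val_eq_cons hi_ne_last, Multiset.map_cons, Multiset.map_cons,
        Multiset.sum_cons, Multiset.sum_cons]
    have h4 : (((Finset.univ \ {i, Fin.last n} : Finset (Fin (n + 1))).val.map d).map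
          fun x => t x m).sum +
        (((Finset.univ \ {i, Fin.last n} : Finset (Fin (n + 1))).val.map d).map
          fun x => s (x + 1) m).sum =
        (((Finset.univ \ {i, Fin.last n} : Finset (Fin (n + 1))).val.map d).map
          fun x => s x m).sum := by
      rw [← Multiset.sum_map_add]
      exact congrArg Multiset.sum (Multiset.map_congr rfl fun x _ => hts x m)
    have h5 := hts (d i) m
    have h6 := hts (d (Fin.last n)) m
    rw [h2] at h1
    change Module.finrank K (I m) + ((((Finset.univ \ {i, Fin.last n} :
      Finset (Fin (n + 1))).val.map d).map fun x => t x m).sum + t δ m + _) = _ at h1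
    omega
  -- `dim I = dim D(A') - dim D(A)`. Passing from `d_i`, `d_ℓ` to `d_i + 1`, `d_ℓ + 1` leaves `t
  -- (d_i) + t (d_ℓ)` by `hts`, and the generator of degree `δ` with the relation of degree `δ + 1`
  -- subtracts `t δ`.
  · intro hspog
    refine (key fun m => ?_).1
    have h1 := hI m
    have h2 := hspog.finrank_gradedPart m
    rw [map_univ_val_ite hi_ne_last, Multiset.map_cons, Multiset.map_cons, Multiset.sum_cons,
      Multiset.sum_cons] at h2
    have h3 := hts (d i) m
    have h4 := hts (d (Fin.last n)) m
    have h5 := hts δ m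
    change _ + s (δ + 1) m = s δ m + (s (d i + 1) m + (s (d (Fin.last n) + 1) m +
      (((Finset.univ \ {i, Fin.last n} : Finset (Fin (n + 1))).val.map d).map
          fun x => s x m).sum)) at h2
    omega
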